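/- Let $n,\mu,s\ge 1$ and $0\le k\le n$ be integers, let $0<\gamma\le 1$ and put $\delta=1-\gamma$. Fix a base $b\ge 2$ for all logarithms ($b=2$ gives bits, $b=e$ gives nats). **Signals.** $\beta_A,\beta_B$ are independent random vectors in $\mathbb{C}^n$ with the same law, that of $\sum_{j=0}^{k-1}\alpha_j e_{\sigma(j)}$, where $\sigma$ is a uniformly random $k$-element subset of $\{0,\dots,n-1\}$ with elements $\sigma(0)<\dots<\sigma(k-1)$, and, independently of $\sigma$, the vector $\alpha$ is uniformly distributed on $[0,1]^k$. **Channel.** $h=h_{AB}=\sum_{l<s} g_l e_{i_l}\in\mathbb{C}^{\mu}$ is independent of $(\beta_A,\beta_B)$, where the positions $(i_0,\dots,i_{s-1})\in\{0,\dots,\mu-1\}^s$ are random with an arbitrary joint law (for instance i.i.d. uniform, or uniform over tuples of distinct positions), and the gains $g_0,\dots,g_{s-1}$ are Gaussian random variables in $\mathbb{C}$, independent of each other and of the positions, none of which is almost surely constant. **Secret.** For $h\in\mathbb{C}^\mu$ and $\beta\in\mathbb{C}^n$ let $h^{\Uparrow}=\sum_{j<\mu}h_je_j\in\mathbb{C}^{n\mu}$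 and $\beta^{\uparrow}=\sum_{j<n}\beta_je_{j\mu}\in\mathbb{C}^{n\mu}$. With $\widehat{\cdot}$ the discrete Fourier transform on $\mathbb{C}^{n\mu}$ and $\cdot$ the entrywise product, the common secret is $$\mathfrak{c}=\widehat{h^{\Uparrow}}\cdot\widehat{\beta_A^{\uparrow}}\cdot\widehat{\beta_B^{\uparrow}} .$$ In the noiseless case the eavesdropper's channels are $h$ (from Alice) and $\gamma h$ (from Bob), and she learns $h\otimes(\beta_A+\gamma\beta_B)$. **Entropy.** For a probability measure $\rho$ let $H^{\mathrm{at}}(\rho)=-\sum_x\rho(\{x\})\log_b\rho(\{x\})$, the sum being over all points $x$ (only the atoms of $\rho$ contribute). The Shannon entropy $H(\rho)$ is $H^{\mathrm{at}}(\rho)$ if $\rho$ is discrete, and $+\infty$ otherwise. $H(X\,|\,Y)$ and $H^{\mathrm{at}}(X\,|\,Y)$ denote the averages, over $y$ distributed as $Y$, of $H$ and $H^{\mathrm{at}}$ of the conditional law of $X$ given $Y=y$; thus $H^{\mathrm{at}}(X\,|\,Y)\le H(X\,|\,Y)$. Let $$H_\gamma(k)=-\log_b\left(\binom{2k}{k}^{-1}\frac{1-\delta^{2k}}{(1-\delta)^k}+\delta^k\right).$$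 **Theorem.** Assume that $17k^4\le n$ or $H_\gamma(k)\ge 1$. Then, for almost every value of $h$ (with respect to the law of the channel, the entropies being computed with $h$ fixed), $$H\big(\mathfrak{c}\,\big|\,h\otimes(\beta_A+\gamma\beta_B)\big)\;\ge\;\Big(1-\frac{17k^4}{n}\Big)\big(H_\gamma(k)-1\big),$$ and the same lower bound holds for $H^{\mathrm{at}}\big(\mathfrak{c}\,\big|\,h\otimes(\beta_A+\gamma\beta_B)\big)$. -/

import Mathlib

open MeasureTheory ProbabilityTheory
open scoped ENNReal

noncomputable section

namespace FullDuplex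

/-! ### Entropy and conditional entropy -/

section Entropy

variable {X Y Ω : Type*} [MeasurableSpace X] [MeasurableSpace Y] [MeasurableSpace Ω]

/-- The sum `- ∑ₓ p(x) log_b p(x)` over all points `x`, where `p(x) = ρ {x}`. Only the atoms of the
probability measure `ρ` contribute; a non-atomic part of `ρ` is counted as `0`. -/
def pointEntropy (b : ℝ) (ρ : Measure X) : ℝ≥0∞ :=
  ∑' x : X, ENNReal.ofReal (-(ρ.real {x} * Real.logb b (ρ.real {x})))

open Classical in
/-- Shannon entropy to base `b` of a probability measure `ρ`: equal to `- ∑ₓ p(x) log_b p(x)`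
if `ρ` is discrete (carried by a countable set), and to `∞` otherwise. -/
def shannonEntropy (b : ℝ) (ρ : Measure X) : ℝ≥0∞ :=
  if ∃ C : Set X, C.Countable ∧ ρ Cᶜ = 0 then pointEntropy b ρ else ∞

variable [StandardBorelSpace X] [Nonempty X]

/-- Conditional Shannon entropy `H(U | V)` to base `b`: the average over `y`, distributed as `V`,
of the Shannon entropy of the conditional law of `U` given `V = y`. -/
def condEntropy (b : ℝ) (U : Ω → X) (V : Ω → Y) (P : Measure Ω) [IsFiniteMeasure P] : ℝ≥0∞ :=
  ∫⁻ y, shannonEntropy b (condDistrib U V P y) ∂(P.map V)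

/-- The part of `H(U | V)` that comes from the atoms of the conditional laws, that is, the average
over `y` of `- ∑ₓ P(U = x | V = y) log_b P(U = x | V = y)`. It is at most `condEntropy`, and equal
to it if the conditional laws are almost surely discrete. -/
def condPointEntropy (b : ℝ) (U : Ω → X) (V : Ω → Y) (P : Measure Ω) [IsFiniteMeasure P] :
    ℝ≥0∞ :=
  ∫⁻ y, pointEntropy b (condDistrib U V P y) ∂(P.map V)

end Entropy

/-! ### The random signals and the random channel -/

/-- The signal `∑_{j < k} α_j e_{σ(j)}` in `ℂⁿ`, where `σ(j)` is the `j`-th element of the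
`k`-element set `σ`. -/
def signal {n k : ℕ} (σ : {σ : Finset (Fin n) // σ.card = k}) (α : Fin k → ℝ) : Fin n → ℂ :=
  ∑ j : Fin k, Pi.single (σ.1.orderEmbOfFin σ.2 j) (α j : ℂ)

/-- The law of `signal σ α` for `σ` uniformly distributed over the `k`-element subsets of
`{0, …, n-1}` and, independently, `α` uniformly distributed on `[0,1]ᵏ`. -/
def signalLaw (n k : ℕ) : Measure (Fin n → ℂ) :=
  (Fintype.card {σ : Finset (Fin n) // σ.card = k} : ℝ≥0∞)⁻¹ •
    ∑ σ : {σ : Finset (Fin n) // σ.card = k},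
      (Measure.pi fun _ : Fin k => (volume : Measure ℝ).restrict (Set.Icc 0 1)).map (signal σ)

/-- The channel `∑_{l < s} g_l e_{i_l}` in `ℂᵐ` with path positions `i` and path gains `g`. -/
def channel {s m : ℕ} (i : Fin s → Fin m) (g : Fin s → ℂ) : Fin m → ℂ :=
  ∑ l : Fin s, Pi.single (i l) (g l)

/-- The law of the channel when the positions have (joint) law `ν`, the gains are independent of
each other and of the positions, and the gain of path `l` has law `G l`. -/
def channelLaw {s m : ℕ} (ν : Measure (Fin s → Fin m)) (G : Fin s → Measure ℂ) :
    Measure (Fin m → ℂ) :=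
  (ν.prod (Measure.pi G)).map fun p => channel p.1 p.2

/-! ### The common secret and the eavesdropper's knowledge -/

/-- The lifting `h^⇑ = ∑_{j < m} h_j e_j` of `h ∈ ℂᵐ` to `ℂ^{nm}`. -/
def liftChannel {m : ℕ} (n : ℕ) (h : Fin m → ℂ) : ZMod (n * m) → ℂ :=
  ∑ j : Fin m, Pi.single ((j : ℕ) : ZMod (n * m)) (h j)

/-- The lifting `β^↑ = ∑_{j < n} β_j e_{jm}` of `β ∈ ℂⁿ` to `ℂ^{nm}`. -/
def liftSignal {n : ℕ} (m : ℕ) (β : Fin n → ℂ) : ZMod (n * m) → ℂ :=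
  ∑ j : Fin n, Pi.single (((j : ℕ) * m : ℕ) : ZMod (n * m)) (β j)

/-- The common secret: the entrywise product of the discrete Fourier transforms of `h^⇑`,
`β_A^↑` and `β_B^↑`. -/
def secret {n m : ℕ} [NeZero n] [NeZero m] (h : Fin m → ℂ) (βA βB : Fin n → ℂ) :
    ZMod (n * m) → ℂ :=
  ZMod.dft (liftChannel n h) * ZMod.dft (liftSignal m βA) * ZMod.dft (liftSignal m βB)

/-- The tensor `h ⊗ v`. -/
def tensor {n m : ℕ} (h : Fin m → ℂ) (v : Fin n → ℂ) : Fin m → Fin n → ℂ :=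
  fun i j => h i * v j

/-- The quantity `H_γ(k)`, with logarithms to base `b`; `1 - γ` is the deviation `δ`. -/
def entropyBound (b γ : ℝ) (k : ℕ) : ℝ :=
  -Real.logb b (((Nat.choose (2 * k) k : ℝ))⁻¹ * ((1 - (1 - γ) ^ (2 * k)) / γ ^ k) + (1 - γ) ^ k)

end FullDuplex

end

noncomputable section

namespace FullDuplex

/-! ### Entropy of a conditional law that is uniform on a finite list of candidates -/

section AbstractEntropy

variable {X Y Ω : Type*} [MeasurableSpace X] [MeasurableSpace Y] [MeasurableSpace Ω]

/-! Almost surely the transform of the lifted channel has no zero (`ae_dft_liftChannel_ne_zero`).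
For such a fixed `h`, the eavesdropper's tensor amounts to `w = β_A + γ β_B`, and the secret amounts
to the cyclic convolution of the lifted signals. What she lacks is which part of the support `S` of
`w` belongs to Bob.

Call `S` good if it has `2k` elements and disjoint pairs in it have distinct sums of positions. A
union bound shows that the supports of the two signals have a good union with probability at least
`1 - 17k⁴/n` (`card_goodPairs_ge`). Given supports `A`, `B` with good union, `w` has density `γ⁻ᵏ`
on `{w ≤ γ on B}` with respect to the uniform law on vectors supported on `S = A ∪ B`
(`map_unifLaw_prod`). This constant is the same for all `B`, so given `w` the support of `β_B` is
uniform among the candidates: the `k`-subsets of `S` on which `w ≤ γ`.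

The signals are nonnegative, so nothing cancels in the convolution and the secret reveals all sums
of a position of Alice and one of Bob. In a good set these sums fix the partition `{A, B}`
(`eq_or_eq_sdiff_of_sums`), so at most two candidates share a secret. The conditional entropy is
therefore at least `log_b #C - 1`, where `C` is the set of candidates.

By convexity, the mean of `log_b #C` on the good event is controlled by the mean of `1 / #C`
(`le_condPointEntropy`). The latter is the mass of a reference measure `l` giving every candidate
the same weight. It is computed by counting good sets against good pairs, a factor `(2k).choose k`,
and by noting that a candidate requires some entry of `w` to be at most `γ`, which has probability
`1 - δ^(2k)`. -/

lemma pointEntropy_le_shannonEntropy (b : ℝ) (ρ : Measure X) :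
    pointEntropy b ρ ≤ shannonEntropy b ρ := by
  unfold shannonEntropy
  split_ifs <;> simp

/-- A probability measure carried by finitely many points, each of mass at most `2 / c`, has
entropy at least `log_b c - 1`. -/
lemma le_pointEntropy [MeasurableSingletonClass X] {b : ℝ} (hb : 2 ≤ b) (ρ : Measure X)
    [IsProbabilityMeasure ρ] (s : Finset X) (hs : ρ (s : Set X)ᶜ = 0) {c : ℕ} (hc : 0 < c)
    (h : ∀ x ∈ s, ρ {x} ≤ 2 / c) :
    ENNReal.ofReal (Real.logb b c - 1) ≤ pointEntropy b ρ := by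
  have hc' : (0 : ℝ) < c := by exact_mod_cast hc
  have hb1 : 1 < b := by linarith
  have hsum : ∑ x ∈ s, ρ {x} = 1 := by
    have h1 := prob_add_prob_compl (μ := ρ) s.measurableSet
    rw [hs, add_zero] at h1
    rw [← h1, sum_measure_singleton]
  have key : ∀ x ∈ s, ENNReal.ofReal (Real.logb b c - 1) * ρ {x} ≤
      ENNReal.ofReal (-(ρ.real {x} * Real.logb b (ρ.real {x}))) := by
    intro x hx
    rcases eq_or_ne (ρ {x}) 0 with h0 | h0
    · simp [h0]
    have hpos : 0 < ρ.real {x} := ENNReal.toReal_pos h0 (measure_ne_top _ _)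
    have hle : ρ.real {x} ≤ 2 / c := by
      have h2 : (2 / c : ℝ≥0∞) = ENNReal.ofReal (2 / c) := by
        rw [ENNReal.ofReal_div_of_pos hc']; simp
      exact ENNReal.toReal_le_of_le_ofReal (by positivity) (h2 ▸ h x hx)
    have hlog : Real.logb b (ρ.real {x}) ≤ 1 - Real.logb b c := by
      calc Real.logb b (ρ.real {x}) ≤ Real.logb b (2 / c) :=
            Real.logb_le_logb_of_le hb1 hpos hle
        _ = Real.logb b 2 - Real.logb b c := Real.logb_div (by norm_num) hc'.ne'
        -- The factor 2 in the mass bound costs `log_b 2`, which is at most 1 because `2 ≤ b`.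
        _ ≤ Real.logb b b - Real.logb b c := by
            gcongr
        _ = _ := by rw [Real.logb_self_eq_one hb1]
    rw [← ofReal_measureReal, ← ENNReal.ofReal_mul' measureReal_nonneg]
    apply ENNReal.ofReal_le_ofReal
    nlinarith
  calc ENNReal.ofReal (Real.logb b c - 1)
      = ∑ x ∈ s, ENNReal.ofReal (Real.logb b c - 1) * ρ {x} := by
        rw [← Finset.mul_sum, hsum, mul_one]
    _ ≤ ∑ x ∈ s, ENNReal.ofReal (-(ρ.real {x} * Real.logb b (ρ.real {x}))) :=
        Finset.sum_le_sum key
    _ ≤ _ := ENNReal.sum_le_tsum s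

variable {ι : Type*} [DecidableEq ι]

lemma measurable_comp_finset [Fintype ι] {Z : Type*} [MeasurableSpace Z] {C : Y → Finset ι}
    (hC : ∀ B, MeasurableSet {y | B ∈ C y}) (g : Finset ι → Z) : Measurable fun y => g (C y) := by
  classical
  let _ : MeasurableSpace (Finset ι) := ⊤
  suffices h : Measurable C from (measurable_from_top (f := g)).comp h
  refine measurable_to_countable' fun s => ?_
  have : C ⁻¹' {s} = ⋂ B, {y | B ∈ C y ↔ B ∈ s} := by
    ext y
    simp [Finset.ext_iff]
  rw [this]
  refine MeasurableSet.iInter fun B => ?_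
  by_cases h : B ∈ s
  · simpa [h] using hC B
  · simp only [h, iff_false]
    exact (hC B).compl

/-- Uniformity is encoded by `hl`: on the event that candidates exist, the joint law is a sum of
graphs of the `F B`, all with the same weight `l`. Testing it on functions of `y` alone shows that
`V` has density `#(C y)` with respect to `l`. -/
lemma lintegral_map_fst_of_uniform [Fintype ι] {P : Measure Ω}
    {V : Ω → Y} {U : Ω → X} (hV : AEMeasurable V P) (hU : AEMeasurable U P)
    {F : ι → Y → X} {C : Y → Finset ι} (hC : ∀ B, MeasurableSet {y | B ∈ C y}) {l : Measure Y}
    (hl : ∀ f : Y × X → ℝ≥0∞, Measurable f →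
      ∫⁻ z in {z | (C z.1).Nonempty}, f z ∂(P.map fun ω => (V ω, U ω)) =
        ∫⁻ y, ∑ B ∈ C y, f (y, F B y) ∂l) {g : Y → ℝ≥0∞} (hg : Measurable g) :
    ∫⁻ y in {y | (C y).Nonempty}, g y ∂(P.map V) = ∫⁻ y, (C y).card * g y ∂l := by
  have hN : MeasurableSet {y | (C y).Nonempty} :=
    measurableSet_setOfPred.2 (measurable_comp_finset hC fun s => s.Nonempty)
  have h1 : P.map V = (P.map fun ω => (V ω, U ω)).map Prod.fst :=
    (AEMeasurable.map_map_of_aemeasurable measurable_fst.aemeasurable (hV.prodMk hU)).symm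
  rw [h1, setLIntegral_map hN hg measurable_fst]
  refine (hl (fun z => g z.1) (hg.comp measurable_fst)).trans ?_
  simp

variable [StandardBorelSpace X] [Nonempty X]

/-- If, given `V = y` with `C y` nonempty, `U` is uniformly chosen among the `F B y` for `B ∈ C y`,
and each value is taken at most twice, then the conditional law has entropy at least
`log_b #(C y) - 1`. -/
lemma ae_le_pointEntropy_condDistrib [Fintype ι] [DecidableEq X] {b : ℝ} (hb : 2 ≤ b)
    (P : Measure Ω) [IsProbabilityMeasure P]
    {V : Ω → Y} {U : Ω → X} (hV : AEMeasurable V P) (hU : AEMeasurable U P)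
    {F : ι → Y → X} (hF : ∀ B, Measurable (F B))
    {C : Y → Finset ι} (hC : ∀ B, MeasurableSet {y | B ∈ C y}) {l : Measure Y}
    (hl : ∀ f : Y × X → ℝ≥0∞, Measurable f →
      ∫⁻ z in {z | (C z.1).Nonempty}, f z ∂(P.map fun ω => (V ω, U ω)) =
        ∫⁻ y, ∑ B ∈ C y, f (y, F B y) ∂l)
    (htwo : ∀ᵐ y ∂l, ∀ B ∈ C y, ((C y).filter fun B' => F B' y = F B y).card ≤ 2) :
    ∀ᵐ y ∂(P.map V), (C y).Nonempty →
      ENNReal.ofReal (Real.logb b (C y).card - 1) ≤ pointEntropy b (condDistrib U V P y) := by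
  have hN : MeasurableSet {y | (C y).Nonempty} :=
    measurableSet_setOfPred.2 (measurable_comp_finset hC fun s => s.Nonempty)
  have hprob : IsProbabilityMeasure (P.map V) := Measure.isProbabilityMeasure_map hV
  have hcomp : P.map V ⊗ₘ condDistrib U V P = P.map fun ω => (V ω, U ω) :=
    compProd_map_condDistrib hU
  have hFg : ∀ B, MeasurableSet {z : Y × X | z.2 = F B z.1} := fun B =>
    measurableSet_eq_fun measurable_snd ((hF B).comp measurable_fst)
  -- the mass of each candidate
  have hatom : ∀ B, ∀ᵐ y ∂(P.map V), B ∈ C y →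
      condDistrib U V P y {F B y} ≤ 2 / ((C y).card : ℝ≥0∞) := by
    intro B
    refine (ae_restrict_iff' (s := {y | B ∈ C y}) (hC B)).1 ?_
    have hm : Measurable fun y => condDistrib U V P y {F B y} :=
      Kernel.measurable_kernel_prodMk_left (κ := condDistrib U V P) (hFg B)
    -- An almost sure inequality is tested by integration over measurable sets, where the joint law
    -- and hence `hl` can be used.
    refine ae_le_of_forall_setLIntegral_le_of_sigmaFinite hm fun D hD _ => ?_
    rw [Measure.restrict_restrict hD]
    set E := D ∩ {y | B ∈ C y} with hE
    have hEm : MeasurableSet E := hD.inter (hC B)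
    have hEN : E ⊆ {y | (C y).Nonempty} := fun y hy => ⟨B, hy.2⟩
    have hS : MeasurableSet {z : Y × X | z.1 ∈ E ∧ z.2 = F B z.1} :=
      (measurable_fst hEm).inter (hFg B)
    have h1 : ∫⁻ y in E, condDistrib U V P y {F B y} ∂(P.map V) =
        ∫⁻ z in {z | (C z.1).Nonempty},
          {z : Y × X | z.1 ∈ E ∧ z.2 = F B z.1}.indicator 1 z ∂(P.map fun ω => (V ω, U ω)) := by
      rw [lintegral_indicator_one hS, Measure.restrict_apply hS,
        Set.inter_eq_left.2 (show {z : Y × X | z.1 ∈ E ∧ z.2 = F B z.1} ⊆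
          {z | (C z.1).Nonempty} from fun z hz => hEN hz.1), ← hcomp, Measure.compProd_apply hS,
        ← lintegral_indicator hEm]
      refine lintegral_congr fun y => ?_
      have hpre : Prod.mk y ⁻¹' {z : Y × X | z.1 ∈ E ∧ z.2 = F B z.1} =
          {x | y ∈ E ∧ x = F B y} := rfl
      rw [hpre]
      by_cases hy : y ∈ E <;> simp [hy]
    have h2 : ∫⁻ y in E, 2 / ((C y).card : ℝ≥0∞) ∂(P.map V) =
        ∫⁻ y, (C y).card * E.indicator (fun y => 2 / ((C y).card : ℝ≥0∞)) y ∂l := by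
      rw [← lintegral_map_fst_of_uniform hV hU hC hl
        ((measurable_comp_finset hC fun s => 2 / (s.card : ℝ≥0∞)).indicator hEm),
        lintegral_indicator hEm, Measure.restrict_restrict hEm, Set.inter_eq_left.2 hEN]
    rw [h1, h2, hl _ (measurable_one.indicator hS)]
    -- Both sides are now integrals against `l`. On `E` the left integrand counts the candidates
    -- with the same value as `B`, at most two, and the right one is `#C * (2 / #C) = 2`.
    refine lintegral_mono_ae ?_
    filter_upwards [htwo] with y hy
    by_cases hyE : y ∈ E
    · have hc : ((C y).card : ℝ≥0∞) ≠ 0 := by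
        simpa using (Finset.Nonempty.ne_empty (hEN hyE))
      have h3 : ∑ B' ∈ C y, {z : Y × X | z.1 ∈ E ∧ z.2 = F B z.1}.indicator
          (1 : Y × X → ℝ≥0∞) (y, F B' y) = ((C y).filter fun B' => F B' y = F B y).card := by
        rw [Finset.card_filter]
        push_cast
        refine Finset.sum_congr rfl fun B' _ => ?_
        simp [Set.indicator, hyE]
      rw [h3, Set.indicator_of_mem hyE, ENNReal.mul_div_cancel hc (by simp)]
      exact_mod_cast hy B hyE.2
    · simp [hyE]
  -- the candidates carry the conditional law
  have hcarrier : ∀ᵐ y ∂(P.map V), (C y).Nonempty →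
      condDistrib U V P y ((((C y).image fun B => F B y : Finset X) : Set X)ᶜ) = 0 := by
    have hS : MeasurableSet {z : Y × X | (C z.1).Nonempty ∧ ∀ B, B ∈ C z.1 → z.2 ≠ F B z.1} := by
      have : {z : Y × X | (C z.1).Nonempty ∧ ∀ B, B ∈ C z.1 → z.2 ≠ F B z.1} =
          Prod.fst ⁻¹' {y | (C y).Nonempty} ∩
            ⋂ B, ((Prod.fst ⁻¹' {y | B ∈ C y})ᶜ ∪ {z : Y × X | z.2 = F B z.1}ᶜ) := by
        ext z; simp [imp_iff_not_or]
      rw [this]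
      exact (measurable_fst hN).inter
        (MeasurableSet.iInter fun B => (measurable_fst (hC B)).compl.union (hFg B).compl)
    have h0 : (P.map V ⊗ₘ condDistrib U V P)
        {z : Y × X | (C z.1).Nonempty ∧ ∀ B, B ∈ C z.1 → z.2 ≠ F B z.1} = 0 := by
      have h1 := hl _ (measurable_one.indicator hS)
      rw [lintegral_indicator_one hS, Measure.restrict_apply hS,
        Set.inter_eq_left.2 (show {z : Y × X | (C z.1).Nonempty ∧ ∀ B, B ∈ C z.1 → z.2 ≠ F B z.1} ⊆
          {z | (C z.1).Nonempty} from fun z hz => hz.1)] at h1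
      rw [hcomp, h1, lintegral_eq_zero_of_ae_eq_zero]
      refine Filter.Eventually.of_forall fun y => ?_
      refine Finset.sum_eq_zero fun B hB => ?_
      simp only [Set.indicator_apply_eq_zero, Set.mem_ofPred_eq]
      exact fun h => absurd rfl (h.2 B hB)
    have h1 := Measure.ae_ae_of_ae_compProd (measure_eq_zero_iff_ae_notMem.1 h0)
    filter_upwards [h1] with y hy hne
    refine measure_mono_null (fun x hx => ?_) (ae_iff.1 hy)
    simp only [Finset.coe_image, Set.mem_compl_iff, Set.mem_image, Finset.mem_coe, not_exists,
      not_and] at hx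
    simpa [hne] using fun B hB h => hx B hB h.symm
  filter_upwards [ae_all_iff.2 hatom, hcarrier] with y h1 h2 hne
  refine le_pointEntropy hb _ _ (h2 hne) hne.card_pos fun x hx => ?_
  obtain ⟨B, hB, rfl⟩ := Finset.mem_image.1 hx
  exact h1 B hB

/-- Lower bound for the conditional entropy in the situation of `ae_le_pointEntropy_condDistrib`,
in terms of a bound `t` for the mean of `1 / #(C V)` over the event that `C V` is nonempty. -/
lemma le_condPointEntropy [Fintype ι] [DecidableEq X] {b : ℝ} (hb : 2 ≤ b)
    (P : Measure Ω) [IsProbabilityMeasure P]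
    {V : Ω → Y} {U : Ω → X} (hV : AEMeasurable V P) (hU : AEMeasurable U P)
    {F : ι → Y → X} (hF : ∀ B, Measurable (F B))
    {C : Y → Finset ι} (hC : ∀ B, MeasurableSet {y | B ∈ C y}) {l : Measure Y}
    (hl : ∀ f : Y × X → ℝ≥0∞, Measurable f →
      ∫⁻ z in {z | (C z.1).Nonempty}, f z ∂(P.map fun ω => (V ω, U ω)) =
        ∫⁻ y, ∑ B ∈ C y, f (y, F B y) ∂l)
    (htwo : ∀ᵐ y ∂l, ∀ B ∈ C y, ((C y).filter fun B' => F B' y = F B y).card ≤ 2)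
    {t : ℝ} (ht : 0 < t)
    (hlt : l {y | (C y).Nonempty} ≤ ENNReal.ofReal t * P.map V {y | (C y).Nonempty}) :
    ENNReal.ofReal (-Real.logb b t - 1) * P.map V {y | (C y).Nonempty} ≤
      condPointEntropy b U V P := by
  have hN : MeasurableSet {y | (C y).Nonempty} :=
    measurableSet_setOfPred.2 (measurable_comp_finset hC fun s => s.Nonempty)
  have hprob : IsProbabilityMeasure (P.map V) := Measure.isProbabilityMeasure_map hV
  have hlogb : 0 < Real.log b := Real.log_pos (by linarith)
  rcases le_total (-Real.logb b t - 1) 0 with hneg | hnn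
  · simp [ENNReal.ofReal_of_nonpos hneg]
  set N := {y | (C y).Nonempty}
  -- Jensen's inequality by a tangent line: `-a` is the slope of the convex function `u ↦ -log_b u`
  -- at `u = t`, and `hpt` compares it with its tangent at `u = 1 / #C`.
  set a : ℝ := (t * Real.log b)⁻¹ with ha
  have ha0 : 0 < a := by positivity
  have hpt : ∀ y ∈ N, ENNReal.ofReal (-Real.logb b t - 1) + ENNReal.ofReal (a * t) ≤
      ENNReal.ofReal (Real.logb b (C y).card - 1) +
        ENNReal.ofReal a * ((C y).card : ℝ≥0∞)⁻¹ := by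
    intro y hy
    have hc : (0 : ℝ) < (C y).card := by exact_mod_cast Finset.Nonempty.card_pos hy
    have hcn : ((C y).card : ℝ≥0∞)⁻¹ = ENNReal.ofReal ((C y).card : ℝ)⁻¹ := by
      rw [ENNReal.ofReal_inv_of_pos hc]; simp
    rw [hcn, ← ENNReal.ofReal_mul ha0.le]
    have hreal : -Real.logb b t - 1 + a * t ≤
        Real.logb b (C y).card - 1 + a * ((C y).card : ℝ)⁻¹ := by
      have h1 := Real.log_le_sub_one_of_pos (x := (((C y).card : ℝ) * t)⁻¹) (by positivity)
      rw [Real.log_inv, Real.log_mul hc.ne' ht.ne'] at h1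
      have h2 : a * t = 1 / Real.log b := by rw [ha]; field_simp
      have h3 : a * ((C y).card : ℝ)⁻¹ = (((C y).card : ℝ) * t)⁻¹ / Real.log b := by
        rw [ha]; field_simp
      rw [h2, h3, Real.logb, Real.logb]
      have h4 := (div_le_div_iff_of_pos_right hlogb).2 h1
      have e1 := sub_div ((((C y).card : ℝ) * t)⁻¹) 1 (Real.log b)
      have e2 := neg_div (Real.log b) (Real.log (C y).card + Real.log t)
      have e3 := add_div (Real.log (C y).card) (Real.log t) (Real.log b)
      linarith
    rw [← ENNReal.ofReal_add hnn (by positivity)]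
    exact (ENNReal.ofReal_le_ofReal hreal).trans ENNReal.ofReal_add_le
  -- The density `#C` of the law of `V` cancels the integrand.
  have hinv : ∫⁻ y in N, ((C y).card : ℝ≥0∞)⁻¹ ∂(P.map V) = l N := by
    rw [lintegral_map_fst_of_uniform hV hU hC hl
      (measurable_comp_finset hC fun s => (s.card : ℝ≥0∞)⁻¹), ← lintegral_indicator_one hN]
    refine lintegral_congr fun y => ?_
    by_cases hy : (C y).Nonempty
    · rw [Set.indicator_of_mem (show y ∈ N from hy)]
      exact ENNReal.mul_inv_cancel (by simpa using hy.ne_empty) (by simp)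
    · rw [Set.indicator_of_notMem (show y ∉ N from hy)]
      simp [Finset.not_nonempty_iff_eq_empty.1 hy]
  have h1 : (ENNReal.ofReal (-Real.logb b t - 1) + ENNReal.ofReal (a * t)) * P.map V N ≤
      (∫⁻ y in N, ENNReal.ofReal (Real.logb b (C y).card - 1) ∂(P.map V)) +
        ENNReal.ofReal a * l N := by
    have hm := measurable_comp_finset hC fun s => (s.card : ℝ≥0∞)⁻¹
    rw [← hinv, ← lintegral_const_mul _ hm, ← lintegral_add_right _ (hm.const_mul _),
      ← setLIntegral_const]
    exact setLIntegral_mono' hN hpt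
  have h2 : (∫⁻ y in N, ENNReal.ofReal (Real.logb b (C y).card - 1) ∂(P.map V)) ≤
      condPointEntropy b U V P := by
    refine le_trans ?_ (setLIntegral_le_lintegral N _)
    refine lintegral_mono_ae ((ae_restrict_iff' hN).2 ?_)
    exact ae_le_pointEntropy_condDistrib hb P hV hU hF hC hl htwo
  have h3 : ENNReal.ofReal a * l N ≤ ENNReal.ofReal (a * t) * P.map V N := by
    rw [ENNReal.ofReal_mul ha0.le, mul_assoc]
    gcongr
  rw [add_mul] at h1
  exact (ENNReal.add_le_add_iff_right
    (ENNReal.mul_ne_top ENNReal.ofReal_ne_top (measure_ne_top _ _))).1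
      (h1.trans (add_le_add h2 h3))

end AbstractEntropy

/-! ### Random pairs of `k`-subsets and sets with distinct pair sums -/

section Counting

/-- The ratio of the binomials is the product of the `(k - i) / (n - i)` for `i < r`, and each
factor is at most `k / n`. -/
lemma choose_sub_mul_pow_le {n k : ℕ} (hk : k ≤ n) (r : ℕ) (hr : r ≤ k) :
    (n - r).choose (k - r) * n ^ r ≤ n.choose k * k ^ r := by
  induction r with
  | zero => simp
  | succ r ih =>
    have ih := ih (by omega)
    obtain ⟨K, rfl⟩ := Nat.exists_eq_add_of_lt (show r < k by omega)
    obtain ⟨N, rfl⟩ := Nat.exists_eq_add_of_lt (show r < n by omega)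
    have e1 : r + N + 1 - r = N + 1 := by omega
    have e2 : r + K + 1 - r = K + 1 := by omega
    have e3 : r + N + 1 - (r + 1) = N := by omega
    have e4 : r + K + 1 - (r + 1) = K := by omega
    rw [e1, e2] at ih
    rw [e3, e4]
    have h1 := Nat.add_one_mul_choose_eq N K
    have h2 : (K + 1) * (r + N + 1) ≤ (r + K + 1) * (N + 1) := by nlinarith
    refine Nat.le_of_mul_le_mul_left (c := N + 1) ?_ (by omega)
    calc (N + 1) * (N.choose K * (r + N + 1) ^ (r + 1))
        = (N + 1).choose (K + 1) * (r + N + 1) ^ r * ((K + 1) * (r + N + 1)) := by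
          rw [← mul_assoc, h1]; ring
      _ ≤ (N + 1).choose (K + 1) * (r + N + 1) ^ r * ((r + K + 1) * (N + 1)) := by gcongr
      _ ≤ (r + N + 1).choose (r + K + 1) * (r + K + 1) ^ r * ((r + K + 1) * (N + 1)) := by gcongr
      _ = _ := by ring

variable {n k : ℕ}

/-- A random `k`-subset of `Fin n` contains a given set of size `r` with probability at most
`(k / n) ^ r`. -/
lemma card_filter_subset_le [NeZero n] (hk : k ≤ n) (R : Finset (Fin n)) :
    (((Finset.powersetCard k Finset.univ).filter fun A => R ⊆ A).card : ℝ) ≤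
      n.choose k * ((k : ℝ) / n) ^ R.card := by
  rcases le_or_gt R.card k with hr | hr
  · have hn : (0 : ℝ) < n := by exact_mod_cast Nat.pos_of_ne_zero (NeZero.ne n)
    have h1 : ((Finset.powersetCard k Finset.univ).filter fun A => R ⊆ A).card ≤
        (n - R.card).choose (k - R.card) := by
      have : (n - R.card).choose (k - R.card) = (Finset.powersetCard (k - R.card) Rᶜ).card := by
        rw [Finset.card_powersetCard, Finset.card_compl, Fintype.card_fin]
      rw [this]
      refine Finset.card_le_card_of_injOn (fun A => A \ R) ?_ ?_
      · intro A hA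
        simp only [Finset.coe_filter, Finset.mem_powersetCard, Set.mem_ofPred_eq] at hA
        refine Finset.mem_coe.2 (Finset.mem_powersetCard.2 ?_)
        refine ⟨fun x hx => by simp at hx; simp [hx.2], ?_⟩
        rw [Finset.card_sdiff_of_subset hA.2, hA.1.2]
      · intro A hA B hB h
        simp only [Finset.coe_filter, Finset.mem_powersetCard, Set.mem_ofPred_eq] at hA hB
        simp only at h
        rw [← Finset.sdiff_union_of_subset hA.2, h, Finset.sdiff_union_of_subset hB.2]
    have h2 := choose_sub_mul_pow_le hk R.card hr
    rw [div_pow, ← mul_div_assoc, le_div_iff₀ (by positivity)]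
    calc (((Finset.powersetCard k Finset.univ).filter fun A => R ⊆ A).card : ℝ) * n ^ R.card
        ≤ (n - R.card).choose (k - R.card) * n ^ R.card := by gcongr
      _ ≤ _ := by exact_mod_cast h2
  · have : (Finset.powersetCard k Finset.univ).filter (fun A => R ⊆ A) = ∅ := by
      refine Finset.filter_eq_empty_iff.2 fun A hA h => ?_
      have := Finset.card_le_card h
      rw [(Finset.mem_powersetCard.1 hA).2] at this
      omega
    rw [this]
    simp only [Finset.card_empty, Nat.cast_zero]
    positivity

/-- The ordered pairs of `k`-element subsets of `Fin n`. -/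
def subsetPairs (n k : ℕ) : Finset (Finset (Fin n) × Finset (Fin n)) :=
  Finset.powersetCard k Finset.univ ×ˢ Finset.powersetCard k Finset.univ

lemma card_subsetPairs (n k : ℕ) : (subsetPairs n k).card = n.choose k ^ 2 := by
  simp [subsetPairs, sq]

lemma card_filter_subset_subset_le [NeZero n] (hk : k ≤ n) (R T : Finset (Fin n)) :
    (((subsetPairs n k).filter fun p => R ⊆ p.1 ∧ T ⊆ p.2).card : ℝ) ≤
      (n.choose k : ℝ) ^ 2 * ((k : ℝ) / n) ^ (R.card + T.card) := by
  have h : (subsetPairs n k).filter (fun p => R ⊆ p.1 ∧ T ⊆ p.2) =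
      ((Finset.powersetCard k Finset.univ).filter fun A => R ⊆ A) ×ˢ
        ((Finset.powersetCard k Finset.univ).filter fun A => T ⊆ A) := by
    rw [subsetPairs, Finset.filter_product]
  rw [h, Finset.card_product]
  push_cast
  calc _ ≤ (n.choose k * ((k : ℝ) / n) ^ R.card) * (n.choose k * ((k : ℝ) / n) ^ T.card) := by
        gcongr
        · exact card_filter_subset_le hk R
        · exact card_filter_subset_le hk T
    _ = _ := by ring

/-- Each of the `2 ^ #R` ways to split `R` between the two subsets has probability at most `(k / n)
^ #R`. -/
lemma card_filter_subset_union_le [NeZero n] (hk : k ≤ n) (R : Finset (Fin n)) :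
    (((subsetPairs n k).filter fun p => R ⊆ p.1 ∪ p.2).card : ℝ) ≤
      (n.choose k : ℝ) ^ 2 * (2 * k / n) ^ R.card := by
  have h : (subsetPairs n k).filter (fun p => R ⊆ p.1 ∪ p.2) ⊆
      R.powerset.biUnion fun T => (subsetPairs n k).filter fun p => T ⊆ p.1 ∧ R \ T ⊆ p.2 := by
    intro p hp
    rw [Finset.mem_filter] at hp
    rw [Finset.mem_biUnion]
    refine ⟨R ∩ p.1, by simp, Finset.mem_filter.2 ⟨hp.1, Finset.inter_subset_right, ?_⟩⟩
    intro x hx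
    have := hp.2 (Finset.mem_sdiff.1 hx).1
    simp at hx this
    tauto
  calc _ ≤ ∑ T ∈ R.powerset,
        (((subsetPairs n k).filter fun p => T ⊆ p.1 ∧ R \ T ⊆ p.2).card : ℝ) := by
        exact_mod_cast (Finset.card_le_card h).trans Finset.card_biUnion_le
    _ ≤ ∑ T ∈ R.powerset, (n.choose k : ℝ) ^ 2 * ((k : ℝ) / n) ^ R.card := by
        refine Finset.sum_le_sum fun T hT => ?_
        have hT := Finset.mem_powerset.1 hT
        have := card_filter_subset_subset_le hk T (R \ T)
        rwa [Finset.card_sdiff_of_subset hT, Nat.add_sub_cancel' (Finset.card_le_card hT)] at this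
    _ = _ := by
        rw [Finset.sum_const, Finset.card_powerset, nsmul_eq_mul]
        push_cast
        rw [mul_div_assoc, mul_pow]
        ring

variable {G : Type*} [AddCommGroup G]

/-- No two disjoint pairs of distinct elements of `S` have the same sum under `e`. -/
def DistinctSums (e : Fin n → G) (S : Finset (Fin n)) : Prop :=
  ∀ a ∈ S, ∀ b ∈ S, ∀ c ∈ S, ∀ d ∈ S, [a, b, c, d].Nodup → e a + e b ≠ e c + e d

open Classical in
/-- The `2 k`-element sets all of whose disjoint pairs have distinct sums under `e`. -/
def goodSets (e : Fin n → G) (k : ℕ) : Finset (Finset (Fin n)) :=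
  (Finset.powersetCard (2 * k) Finset.univ).filter (DistinctSums e)

lemma mem_goodSets {e : Fin n → G} {S : Finset (Fin n)} :
    S ∈ goodSets e k ↔ S.card = 2 * k ∧ DistinctSums e S := by
  simp [goodSets]

lemma disjoint_of_union_mem_goodSets {e : Fin n → G} {A B : Finset (Fin n)} (hA : A.card = k)
    (hB : B.card = k) (h : A ∪ B ∈ goodSets e k) : Disjoint A B := by
  rw [mem_goodSets] at h
  rw [← Finset.card_union_eq_card_add_card]
  omega

/-- Union bound. A pair is bad if the two sets share one of `n` points, each with probability at
most `(k/n)²`, or if their union contains a quadruple with coinciding sums. Since `e` is injective,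
three entries of such a quadruple determine the fourth, so there are at most `n³`, each covered with
probability at most `(2k/n)⁴`. -/
lemma card_goodPairs_ge [NeZero n] (hk : k ≤ n) (e : Fin n → G) (he : Function.Injective e) :
    (n.choose k : ℝ) ^ 2 * (1 - 17 * (k : ℝ) ^ 4 / n) ≤
      ((subsetPairs n k).filter fun p => p.1 ∪ p.2 ∈ goodSets e k).card := by
  classical
  have hn : (0 : ℝ) < n := by exact_mod_cast Nat.pos_of_ne_zero (NeZero.ne n)
  set Q : Finset (Fin n × Fin n × Fin n × Fin n) :=
    Finset.univ.filter fun q => [q.1, q.2.1, q.2.2.1, q.2.2.2].Nodup ∧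
      e q.1 + e q.2.1 = e q.2.2.1 + e q.2.2.2 with hQ
  have hQc : (Q.card : ℝ) ≤ (n : ℝ) ^ 3 := by
    have : Q.card ≤ (Finset.univ : Finset (Fin n × Fin n × Fin n)).card := by
      refine Finset.card_le_card_of_injOn (fun q => (q.1, q.2.1, q.2.2.1)) (by simp) ?_
      rintro ⟨a, b, c, d⟩ h ⟨a', b', c', d'⟩ h' heq
      simp only [hQ, Finset.coe_filter, Finset.mem_univ, true_and, Set.mem_ofPred_eq] at h h'
      simp only [Prod.mk.injEq] at heq
      obtain ⟨rfl, rfl, rfl⟩ := heq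
      have := h.2.symm.trans h'.2
      rw [add_right_inj] at this
      rw [he this]
    have h3 : (Finset.univ : Finset (Fin n × Fin n × Fin n)).card = n ^ 3 := by
      simp; ring
    rw [h3] at this
    exact_mod_cast this
  have hcover : subsetPairs n k ⊆
      ((subsetPairs n k).filter fun p => p.1 ∪ p.2 ∈ goodSets e k) ∪
      ((Finset.univ.biUnion fun a : Fin n =>
        (subsetPairs n k).filter fun p => {a} ⊆ p.1 ∧ {a} ⊆ p.2) ∪
      (Q.biUnion fun q => (subsetPairs n k).filter fun p =>
        {q.1, q.2.1, q.2.2.1, q.2.2.2} ⊆ p.1 ∪ p.2)) := by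
    rintro ⟨A, B⟩ hp
    have hp' := hp
    simp only [subsetPairs, Finset.mem_product, Finset.mem_powersetCard] at hp'
    simp only [Finset.mem_union, Finset.mem_filter, Finset.mem_biUnion, hp, true_and,
      Finset.mem_univ]
    by_cases hd : Disjoint A B
    · by_cases hs : DistinctSums e (A ∪ B)
      · left
        rw [mem_goodSets, Finset.card_union_of_disjoint hd]
        exact ⟨by omega, hs⟩
      · right; right
        simp only [DistinctSums] at hs
        push Not at hs
        obtain ⟨a, ha, b, hb, c, hc, d, hd, hnd, hsum⟩ := hs
        refine ⟨(a, b, c, d), ?_, ?_⟩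
        · rw [hQ, Finset.mem_filter]
          exact ⟨Finset.mem_univ _, hnd, hsum⟩
        · intro x hx
          simp only [Finset.mem_insert, Finset.mem_singleton] at hx
          rcases hx with rfl | rfl | rfl | rfl <;> assumption
    · right; left
      obtain ⟨a, ha, hb⟩ := Finset.not_disjoint_iff.1 hd
      exact ⟨a, by simpa using ha, by simpa using hb⟩
  have hcard : ((subsetPairs n k).card : ℝ) ≤
      ((subsetPairs n k).filter fun p => p.1 ∪ p.2 ∈ goodSets e k).card +
      (∑ a : Fin n, (((subsetPairs n k).filter fun p => {a} ⊆ p.1 ∧ {a} ⊆ p.2).card : ℝ) +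
      ∑ q ∈ Q, (((subsetPairs n k).filter fun p =>
        {q.1, q.2.1, q.2.2.1, q.2.2.2} ⊆ p.1 ∪ p.2).card : ℝ)) := by
    have h1 := Finset.card_le_card hcover
    have h2 := h1.trans ((Finset.card_union_le _ _).trans (add_le_add_right
      ((Finset.card_union_le _ _).trans (add_le_add Finset.card_biUnion_le
        Finset.card_biUnion_le)) _))
    exact_mod_cast h2
  have hs1 : ∑ a : Fin n, (((subsetPairs n k).filter fun p => {a} ⊆ p.1 ∧ {a} ⊆ p.2).card : ℝ) ≤
      n * ((n.choose k : ℝ) ^ 2 * ((k : ℝ) / n) ^ 2) := by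
    refine (Finset.sum_le_card_nsmul _ _ ((n.choose k : ℝ) ^ 2 * ((k : ℝ) / n) ^ 2) fun a _ => ?_).trans
      (by simp)
    simpa using card_filter_subset_subset_le hk {a} {a}
  have hs2 : ∑ q ∈ Q, (((subsetPairs n k).filter fun p =>
        {q.1, q.2.1, q.2.2.1, q.2.2.2} ⊆ p.1 ∪ p.2).card : ℝ) ≤
      n ^ 3 * ((n.choose k : ℝ) ^ 2 * (2 * k / n) ^ 4) := by
    refine (Finset.sum_le_card_nsmul _ _ ((n.choose k : ℝ) ^ 2 * (2 * k / n) ^ 4)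
      fun q hq => ?_).trans ?_
    · have := card_filter_subset_union_le hk {q.1, q.2.1, q.2.2.1, q.2.2.2}
      have hq4 : ({q.1, q.2.1, q.2.2.1, q.2.2.2} : Finset (Fin n)).card = 4 := by
        have h := List.toFinset_card_of_nodup (Finset.mem_filter.1 hq).2.1
        simpa using h
      rwa [hq4] at this
    · rw [nsmul_eq_mul]
      gcongr
  rw [card_subsetPairs] at hcard
  push_cast at hcard
  -- The total `k²/n + 16k⁴/n` is at most `17k⁴/n`.
  have hk2 : (k : ℝ) ^ 2 ≤ (k : ℝ) ^ 4 := by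
    rcases Nat.eq_zero_or_pos k with rfl | h
    · simp
    · exact pow_le_pow_right₀ (by exact_mod_cast h) (by norm_num)
  have e1 : (n : ℝ) * ((n.choose k : ℝ) ^ 2 * ((k : ℝ) / n) ^ 2) =
      (n.choose k : ℝ) ^ 2 * ((k : ℝ) ^ 2 / n) := by field_simp
  have e2 : (n : ℝ) ^ 3 * ((n.choose k : ℝ) ^ 2 * (2 * k / n) ^ 4) =
      (n.choose k : ℝ) ^ 2 * (16 * (k : ℝ) ^ 4 / n) := by field_simp; ring
  rw [e1] at hs1
  rw [e2] at hs2
  have e3 : (n.choose k : ℝ) ^ 2 * ((k : ℝ) ^ 2 / n) ≤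
      (n.choose k : ℝ) ^ 2 * ((k : ℝ) ^ 4 / n) := by gcongr
  have e4 : (n.choose k : ℝ) ^ 2 * (1 - 17 * (k : ℝ) ^ 4 / n) = (n.choose k : ℝ) ^ 2 -
      (n.choose k : ℝ) ^ 2 * (16 * (k : ℝ) ^ 4 / n) - (n.choose k : ℝ) ^ 2 * ((k : ℝ) ^ 4 / n) := by
    ring
  linarith

/-- A partition of `S` into two nonempty parts is determined up to order by the sums of pairs
with one element in each part. -/
lemma eq_or_eq_sdiff_of_sums {e : Fin n → G} {S B B' : Finset (Fin n)} (hS : DistinctSums e S)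
    (he : Function.Injective e)
    (hB : B ⊆ S) (hB' : B' ⊆ S) (hBne : B.Nonempty) (hAne : (S \ B).Nonempty)
    (h : ∀ a ∈ S \ B, ∀ b ∈ B, ∃ a' ∈ S \ B', ∃ b' ∈ B', e a + e b = e a' + e b') :
    B' = B ∨ B' = S \ B := by
  -- Distinct sums and injectivity force `{a, b} = {a', b'}`, so exactly one of `a`, `b` lies in
  -- `B'`. Thus `B'` is a colour class of a 2-colouring of the complete bipartite graph between `S \
  -- B` and `B`, which is unique up to swapping the colours.
  have key : ∀ a ∈ S \ B, ∀ b ∈ B, (a ∈ B' ↔ b ∉ B') := by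
    intro a ha b hb
    obtain ⟨a', ha', b', hb', hsum⟩ := h a ha b hb
    rw [Finset.mem_sdiff] at ha ha'
    have h1 : a ≠ b := by rintro rfl; exact ha.2 hb
    have h2 : a' ≠ b' := by rintro rfl; exact ha'.2 hb'
    by_cases h3 : a = a'
    · subst h3
      rw [add_right_inj] at hsum
      have := he hsum
      subst this
      tauto
    by_cases h4 : a = b'
    · subst h4
      rw [add_comm, add_left_inj] at hsum
      have := he hsum
      subst this
      tauto
    by_cases h5 : b = a'
    · subst h5
      rw [add_comm, add_right_inj] at hsum
      exact absurd (he hsum) h4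
    by_cases h6 : b = b'
    · subst h6
      rw [add_left_inj] at hsum
      exact absurd (he hsum) h3
    refine absurd hsum (hS a ha.1 b (hB hb) a' ha'.1 b' (hB' hb') ?_)
    simp
    tauto
  obtain ⟨b0, hb0⟩ := hBne
  obtain ⟨a0, ha0⟩ := hAne
  by_cases h0 : b0 ∈ B'
  · left
    ext x
    constructor
    · intro hx
      by_contra hxB
      exact (key x (Finset.mem_sdiff.2 ⟨hB' hx, hxB⟩) b0 hb0).1 hx h0
    · intro hx
      have h1 := key a0 ha0 b0 hb0
      have h2 := key a0 ha0 x hx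
      tauto
  · right
    ext x
    constructor
    · intro hx
      refine Finset.mem_sdiff.2 ⟨hB' hx, fun hxB => ?_⟩
      have h1 := key a0 ha0 b0 hb0
      have h2 := key a0 ha0 x hxB
      tauto
    · intro hx
      exact (key x hx b0 hb0).2 h0

end Counting

/-! ### The secret as a convolution -/

section Secret

variable {n m : ℕ}

/-- The position of the `j`-th entry of `β` in `β^↑`. -/
def position (n m : ℕ) (j : Fin n) : ZMod (n * m) := ((j : ℕ) * m : ℕ)

lemma position_injective [NeZero m] : Function.Injective (position n m) := by
  intro a b h
  have hm : 0 < m := Nat.pos_of_ne_zero (NeZero.ne m)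
  have h1 := (ZMod.natCast_eq_natCast_iff' _ _ _).1 h
  rw [Nat.mod_eq_of_lt (Nat.mul_lt_mul_of_pos_right a.2 hm),
    Nat.mod_eq_of_lt (Nat.mul_lt_mul_of_pos_right b.2 hm)] at h1
  exact Fin.ext (Nat.eq_of_mul_eq_mul_right hm h1)

lemma dft_single {N : ℕ} [NeZero N] (i j : ZMod N) (c : ℂ) :
    ZMod.dft (Pi.single i c : ZMod N → ℂ) j = ZMod.stdAddChar (-(i * j)) * c := by
  rw [ZMod.dft_apply, Finset.sum_eq_single i]
  · simp
  · intro b _ hb; simp [hb]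
  · simp

variable [NeZero n] [NeZero m]

lemma dft_liftSignal (β : Fin n → ℂ) (j : ZMod (n * m)) :
    ZMod.dft (liftSignal m β) j =
      ∑ a, ZMod.stdAddChar (-(position n m a * j)) * β a := by
  rw [liftSignal, map_sum, Finset.sum_apply]
  exact Finset.sum_congr rfl fun a _ => dft_single _ _ _

/-- Convolution theorem, with the cyclic convolution written as a sum of point masses so that its
support can be read off. -/
lemma dft_liftSignal_mul (x y : Fin n → ℂ) :
    ZMod.dft (liftSignal m x) * ZMod.dft (liftSignal m y) =
      ZMod.dft (∑ a, ∑ b, Pi.single (position n m a + position n m b) (x a * y b)) := by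
  ext j
  rw [Pi.mul_apply, dft_liftSignal, dft_liftSignal, Finset.sum_mul_sum, map_sum, Finset.sum_apply]
  refine Finset.sum_congr rfl fun a _ => ?_
  rw [map_sum, Finset.sum_apply]
  refine Finset.sum_congr rfl fun b _ => ?_
  rw [dft_single, add_mul, neg_add, AddChar.map_add_eq_mul]
  ring

/-- If the channel has no spectral zero, then the secret determines the set of sums of positions
of nonzero entries of two nonnegative signals. -/
lemma exists_position_add_eq {h : Fin m → ℂ} (hh : ∀ j, ZMod.dft (liftChannel n h) j ≠ 0)
    {x y x' y' : Fin n → ℝ} (hx : 0 ≤ x) (hy : 0 ≤ y)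
    (heq : secret h (fun i => (x i : ℂ)) (fun i => (y i : ℂ)) =
      secret h (fun i => (x' i : ℂ)) (fun i => (y' i : ℂ)))
    {a b : Fin n} (ha : x a ≠ 0) (hb : y b ≠ 0) :
    ∃ a' b', x' a' ≠ 0 ∧ y' b' ≠ 0 ∧
      position n m a + position n m b = position n m a' + position n m b' := by
  by_contra! hcon
  have h1 : ZMod.dft (liftSignal m fun i => (x i : ℂ)) * ZMod.dft (liftSignal m fun i => (y i : ℂ)) =
      ZMod.dft (liftSignal m fun i => (x' i : ℂ)) *
        ZMod.dft (liftSignal m fun i => (y' i : ℂ)) := by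
    ext j
    have := congrFun heq j
    simp only [secret, Pi.mul_apply, mul_assoc] at this
    exact mul_left_cancel₀ (hh j) this
  rw [dft_liftSignal_mul, dft_liftSignal_mul] at h1
  have h2 := congrFun (ZMod.dft.injective h1) (position n m a + position n m b)
  simp only [Finset.sum_apply, Pi.single_apply, ← Complex.ofReal_mul] at h2
  -- The coefficient of the convolution at the sum of the two positions. It vanishes for the primed
  -- signals by `hcon`, hence also for `x` and `y`. There all terms are nonnegative, so the nonzero
  -- term `x a * y b` gives a contradiction.
  have h3 : ∑ c, ∑ d, (if position n m a + position n m b = position n m c + position n m d then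
      x c * y d else 0) = 0 := by
    have h4 : ∑ c, ∑ d, (if position n m a + position n m b = position n m c + position n m d then
        ((x' c * y' d : ℝ) : ℂ) else 0) = 0 := by
      refine Finset.sum_eq_zero fun c _ => Finset.sum_eq_zero fun d _ => ?_
      split_ifs with hcd
      · by_cases hc : x' c = 0
        · simp [hc]
        by_cases hd : y' d = 0
        · simp [hd]
        exact absurd hcd (hcon c d hc hd)
      · rfl
    rw [h4] at h2
    have h5 : ((∑ c, ∑ d, (if position n m a + position n m b = position n m c + position n m d then
      x c * y d else 0) : ℝ) : ℂ) = 0 := by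
      rw [← h2]
      push_cast
      refine Finset.sum_congr rfl fun c _ => Finset.sum_congr rfl fun d _ => ?_
      split_ifs <;> simp
    exact_mod_cast h5
  have hnn : ∀ c d, 0 ≤ (if position n m a + position n m b = position n m c + position n m d then
      x c * y d else 0) := by
    intro c d
    split_ifs
    · exact mul_nonneg (hx c) (hy d)
    · rfl
  rw [Finset.sum_eq_zero_iff_of_nonneg fun c _ => Finset.sum_nonneg fun d _ => hnn c d] at h3
  have h4 := h3 a (Finset.mem_univ _)
  rw [Finset.sum_eq_zero_iff_of_nonneg fun d _ => hnn a d] at h4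
  have h5 := h4 b (Finset.mem_univ _)
  simp [ha, hb] at h5

end Secret

/-! ### Almost surely the channel has no spectral zero -/

section Channel

/-- A Gaussian measure on `ℂ` that is not a Dirac mass has no atoms. -/
lemma IsGaussian.measure_singleton_eq_zero {μ : Measure ℂ} [IsGaussian μ]
    (hμ : ∀ z, μ ≠ Measure.dirac z) (z : ℂ) : μ {z} = 0 := by
  -- One real projection with positive variance suffices, since its law has no atoms. If both the
  -- real and the imaginary part had variance zero, `μ` would be a Dirac mass.
  have key : ∀ L : StrongDual ℝ ℂ, Var[L; μ].toNNReal ≠ 0 → μ {z} = 0 := by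
    intro L hL
    have h1 := IsGaussian.map_eq_gaussianReal (μ := μ) L
    have := nullSingletonClass_gaussianReal (μ := ∫ x, L x ∂μ) hL
    have h2 : μ.map L {L z} = 0 := by rw [h1]; exact measure_singleton _
    rw [Measure.map_apply (by fun_prop) (measurableSet_singleton _)] at h2
    exact measure_mono_null (by simp) h2
  have hconst : ∀ L : StrongDual ℝ ℂ, Var[L; μ].toNNReal = 0 → ∀ᵐ x ∂μ, L x = ∫ x, L x ∂μ := by
    intro L hL
    have h1 := IsGaussian.map_eq_gaussianReal (μ := μ) L
    rw [hL, gaussianReal_zero_var] at h1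
    refine ae_of_ae_map (f := L) (p := fun y => y = ∫ x, L x ∂μ) (by fun_prop) ?_
    rw [h1]
    exact (ae_dirac_iff (measurableSet_singleton _)).2 rfl
  by_cases hre : Var[Complex.reCLM; μ].toNNReal = 0
  · by_cases him : Var[Complex.imCLM; μ].toNNReal = 0
    · set c : ℂ := ⟨∫ x, Complex.reCLM x ∂μ, ∫ x, Complex.imCLM x ∂μ⟩
      refine absurd ?_ (hμ c)
      have h : (id : ℂ → ℂ) =ᵐ[μ] fun _ => c := by
        filter_upwards [hconst _ hre, hconst _ him] with x h1 h2
        exact Complex.ext h1 h2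
      have h2 : μ.map id = μ.map fun _ => c := Measure.map_congr h
      rwa [Measure.map_id, Measure.map_const, measure_univ, one_smul] at h2
    · exact key _ him
  · exact key _ hre

/-- With the other gains fixed, the linear form vanishes for only one value of `g 0`, which is not
an atom. -/
lemma ae_sum_mul_ne_zero {s : ℕ} (G : Fin (s + 1) → Measure ℂ) [∀ l, IsProbabilityMeasure (G l)]
    (h0 : ∀ z, G 0 {z} = 0) {c : Fin (s + 1) → ℂ} (hc : c 0 ≠ 0) :
    ∀ᵐ g ∂(Measure.pi G), ∑ l, c l * g l ≠ 0 := by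
  have h1 := (measurePreserving_piFinSuccAbove G 0).quasiMeasurePreserving.ae
    (p := fun q => c 0 * q.1 + ∑ l : Fin s, c l.succ * q.2 l ≠ 0) ?_
  · filter_upwards [h1] with g hg
    rw [Fin.sum_univ_succ]
    exact hg
  · rw [ae_iff]
    simp only [not_not]
    have hm : MeasurableSet {q : ℂ × (Fin s → ℂ) | c 0 * q.1 + ∑ l : Fin s, c l.succ * q.2 l = 0} :=
      measurableSet_eq_fun (by fun_prop) (by fun_prop)
    refine (Measure.prod_apply_symm hm).trans ?_
    rw [lintegral_eq_zero_of_ae_eq_zero]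
    refine Filter.Eventually.of_forall fun r => ?_
    refine measure_mono_null (fun z hz => ?_) (h0 (-(∑ l : Fin s, c l.succ * r l) / c 0))
    have hz : c 0 * z + ∑ l : Fin s, c l.succ * r l = 0 := hz
    rw [Set.mem_singleton_iff, eq_div_iff hc, mul_comm]
    exact eq_neg_of_add_eq_zero_left hz

variable {n m s : ℕ}

lemma channel_apply (i : Fin s → Fin m) (g : Fin s → ℂ) (j : Fin m) :
    channel i g j = ∑ l, if j = i l then g l else 0 := by
  simp [channel, Finset.sum_apply, Pi.single_apply]

lemma measurable_channel :
    Measurable fun p : (Fin s → Fin m) × (Fin s → ℂ) => channel p.1 p.2 := by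
  refine measurable_pi_lambda _ fun j => ?_
  simp only [channel_apply]
  refine Finset.measurable_fun_sum _ fun l _ => ?_
  refine Measurable.ite ?_ (by fun_prop) measurable_const
  have h : Measurable fun p : (Fin s → Fin m) × (Fin s → ℂ) => p.1 l := by fun_prop
  exact measurableSet_eq_fun measurable_const h

variable [NeZero n] [NeZero m]

lemma dft_liftChannel (h : Fin m → ℂ) (j : ZMod (n * m)) :
    ZMod.dft (liftChannel n h) j =
      ∑ a : Fin m, ZMod.stdAddChar (-(((a : ℕ) : ZMod (n * m)) * j)) * h a := by
  rw [liftChannel, map_sum, Finset.sum_apply]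
  exact Finset.sum_congr rfl fun a _ => dft_single _ _ _

/-- Expanding over paths rather than over entries of the channel keeps every coefficient a root of
unity, even when several paths share a position. Hence the joint law of the positions plays no role.
-/
lemma dft_liftChannel_channel (i : Fin s → Fin m) (g : Fin s → ℂ) (j : ZMod (n * m)) :
    ZMod.dft (liftChannel n (channel i g)) j =
      ∑ l, ZMod.stdAddChar (-(((i l : ℕ) : ZMod (n * m)) * j)) * g l := by
  rw [dft_liftChannel]
  simp only [channel_apply, Finset.mul_sum]
  rw [Finset.sum_comm]
  refine Finset.sum_congr rfl fun l _ => ?_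
  simp

/-- Almost surely the channel has no spectral zero. -/
lemma ae_dft_liftChannel_ne_zero (hs : 1 ≤ s) (ν : Measure (Fin s → Fin m))
    [IsProbabilityMeasure ν] (G : Fin s → Measure ℂ) [∀ l, IsGaussian (G l)]
    (hG : ∀ l z, G l ≠ Measure.dirac z) :
    ∀ᵐ h ∂(channelLaw ν G), ∀ j, ZMod.dft (liftChannel n h) j ≠ 0 := by
  obtain ⟨s, rfl⟩ := Nat.exists_eq_add_of_le' hs
  rw [ae_all_iff]
  intro j
  have hmeas : MeasurableSet {h : Fin m → ℂ | ZMod.dft (liftChannel n h) j = 0} := by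
    simp only [dft_liftChannel]
    exact measurableSet_eq_fun (by fun_prop) (by fun_prop)
  refine (ae_map_iff measurable_channel.aemeasurable hmeas.compl).2 ?_
  suffices h : (ν.prod (Measure.pi G)) {p : (Fin (s + 1) → Fin m) × (Fin (s + 1) → ℂ) |
      ZMod.dft (liftChannel n (channel p.1 p.2)) j = 0} = 0 from
    measure_eq_zero_iff_ae_notMem.1 h
  refine (Measure.measure_prod_null (measurable_channel hmeas)).2 ?_
  refine Filter.Eventually.of_forall fun i => ?_
  have h1 := ae_sum_mul_ne_zero G (IsGaussian.measure_singleton_eq_zero (hG 0))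
    (c := fun l => ZMod.stdAddChar (-(((i l : ℕ) : ZMod (n * m)) * j)))
    (AddChar.val_isUnit _ _).ne_zero
  rw [ae_iff] at h1
  simp only [not_not] at h1
  refine measure_mono_null (fun g hg => ?_) h1
  have hg : ZMod.dft (liftChannel n (channel i g)) j = 0 := hg
  rw [dft_liftChannel_channel] at hg
  exact hg

end Channel

/-! ### Signals with independent uniform entries on a given support -/

section UniformSignals

variable {n k : ℕ}

/-- The uniform distribution on `[0,1]` for `i ∈ S`, and the Dirac mass at `0` otherwise. -/
def coordLaw (S : Finset (Fin n)) (i : Fin n) : Measure ℝ :=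
  if i ∈ S then volume.restrict (Set.Icc 0 1) else Measure.dirac 0

instance isProbabilityMeasure_unitInterval :
    IsProbabilityMeasure ((volume : Measure ℝ).restrict (Set.Icc 0 1)) := ⟨by simp⟩

instance (S : Finset (Fin n)) (i : Fin n) : IsProbabilityMeasure (coordLaw S i) := by
  unfold coordLaw
  split_ifs <;> infer_instance

/-- The law of a random vector with support `S` and independent uniform entries. -/
def unifLaw (S : Finset (Fin n)) : Measure (Fin n → ℝ) := Measure.pi (coordLaw S)

instance (S : Finset (Fin n)) : IsProbabilityMeasure (unifLaw S) := by
  unfold unifLaw; infer_instance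

lemma ae_unifLaw (S : Finset (Fin n)) :
    ∀ᵐ x ∂(unifLaw S), ∀ i, (i ∈ S → 0 < x i ∧ x i ≤ 1) ∧ (i ∉ S → x i = 0) := by
  rw [ae_all_iff]
  intro i
  refine (measurePreserving_eval (coordLaw S) i).quasiMeasurePreserving.ae
    (p := fun t => (i ∈ S → 0 < t ∧ t ≤ 1) ∧ (i ∉ S → t = 0)) ?_
  by_cases hi : i ∈ S
  · simp only [hi, coordLaw, if_true, forall_const, not_true, false_implies, and_true]
    -- Discarding the null value 0 makes the support exactly `S`.
    rw [Measure.restrict_congr_set Ioc_ae_eq_Icc.symm]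
    filter_upwards [ae_restrict_mem measurableSet_Ioc] with t ht using ht
  · simp only [hi, coordLaw, if_false, false_implies, true_and, not_false_iff, forall_const]
    exact (ae_dirac_iff (measurableSet_singleton _)).2 rfl

lemma unifLaw_map_restrict (σ : {σ : Finset (Fin n) // σ.card = k}) :
    (unifLaw σ.1).map (fun x (j : Fin k) => x (σ.1.orderEmbOfFin σ.2 j)) =
      Measure.pi fun _ => (volume : Measure ℝ).restrict (Set.Icc 0 1) := by
  symm
  refine Measure.pi_eq fun t ht => ?_
  rw [Measure.map_apply (by fun_prop) (MeasurableSet.univ_pi ht)]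
  set f := σ.1.orderEmbOfFin σ.2 with hf
  -- The preimage is a box in all `n` coordinates, with no constraint off the range of `f`, so its
  -- measure is a product.
  have hpre : (fun x (j : Fin k) => x (f j)) ⁻¹' Set.univ.pi t =
      Set.univ.pi fun i : Fin n => {z : ℝ | ∀ j, f j = i → z ∈ t j} := by
    ext x
    simp only [Set.mem_preimage, Set.mem_univ_pi, Set.mem_ofPred_eq]
    exact ⟨fun h i j hj => hj ▸ h j, fun h j => h _ j rfl⟩
  have him : σ.1 = Finset.univ.image f := by
    rw [hf, Finset.image_orderEmbOfFin_univ]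
  rw [hpre, unifLaw, Measure.pi_pi, ← Finset.prod_subset (Finset.subset_univ σ.1), him,
    Finset.prod_image f.injective.injOn]
  · refine Finset.prod_congr rfl fun j _ => ?_
    have h1 : {z : ℝ | ∀ j', f j' = f j → z ∈ t j'} = t j := by
      ext z
      simp [f.injective.eq_iff]
    rw [h1, coordLaw, if_pos (by rw [← him]; exact Finset.orderEmbOfFin_mem _ _ _)]
  · intro i _ hi
    have h1 : {z : ℝ | ∀ j, f j = i → z ∈ t j} = Set.univ := by
      ext z
      simp only [Set.mem_ofPred_eq, Set.mem_univ, iff_true]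
      rintro j rfl
      exact absurd (Finset.orderEmbOfFin_mem _ _ _) hi
    rw [h1, measure_univ]

/-- Real vectors as complex vectors. -/
def toComplex (x : Fin n → ℝ) : Fin n → ℂ := fun i => (x i : ℂ)

lemma measurable_toComplex : Measurable (toComplex : (Fin n → ℝ) → Fin n → ℂ) := by
  unfold toComplex; fun_prop

lemma measurable_signal (σ : {σ : Finset (Fin n) // σ.card = k}) : Measurable (signal σ) := by
  unfold signal
  refine Finset.measurable_fun_sum _ fun j _ => ?_
  refine measurable_pi_lambda _ fun i => ?_
  simp only [Pi.single_apply]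
  split_ifs <;> fun_prop

lemma signal_restrict (σ : {σ : Finset (Fin n) // σ.card = k}) {x : Fin n → ℝ}
    (hx : ∀ i ∉ σ.1, x i = 0) :
    signal σ (fun j => x (σ.1.orderEmbOfFin σ.2 j)) = toComplex x := by
  ext i
  simp only [signal, Finset.sum_apply, Pi.single_apply, toComplex]
  by_cases hi : i ∈ σ.1
  · have : i ∈ Finset.univ.image (σ.1.orderEmbOfFin σ.2) := by
      rwa [Finset.image_orderEmbOfFin_univ]
    obtain ⟨j, -, rfl⟩ := Finset.mem_image.1 this
    simp
  · rw [hx i hi]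
    refine (Finset.sum_eq_zero fun j _ => if_neg ?_).trans (by simp)
    rintro rfl
    exact hi (Finset.orderEmbOfFin_mem _ _ _)

/-- Rewrites the law as a mixture of product measures on real vectors, for which later computations
are coordinatewise. -/
lemma signalLaw_eq (n k : ℕ) : signalLaw n k = (n.choose k : ℝ≥0∞)⁻¹ •
    ∑ A ∈ Finset.powersetCard k Finset.univ, (unifLaw A).map (toComplex (n := n)) := by
  have hcard : Fintype.card {σ : Finset (Fin n) // σ.card = k} = n.choose k := by simp
  rw [signalLaw, hcard]
  congr 1
  have h1 : ∀ σ : {σ : Finset (Fin n) // σ.card = k},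
      (Measure.pi fun _ : Fin k => (volume : Measure ℝ).restrict (Set.Icc 0 1)).map (signal σ) =
        (unifLaw σ.1).map toComplex := by
    intro σ
    rw [← unifLaw_map_restrict σ, Measure.map_map (measurable_signal σ) (by fun_prop)]
    refine Measure.map_congr ?_
    filter_upwards [ae_unifLaw σ.1] with x hx
    exact signal_restrict σ fun i hi => (hx i).2 hi
  rw [Finset.sum_congr rfl fun σ _ => h1 σ]
  refine (Finset.sum_subtype _ (fun A => ?_) fun A => (unifLaw A).map toComplex).symm
  simp

lemma Measure.pi_eq_smul_pi {ι : Type*} [Fintype ι] {μ ρ : ι → Measure ℝ} [∀ i, SigmaFinite (μ i)]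
    [∀ i, SigmaFinite (ρ i)] {c : ι → ℝ≥0∞} (h : ∀ i, μ i = c i • ρ i) :
    Measure.pi μ = (∏ i, c i) • Measure.pi ρ := by
  refine Measure.pi_eq fun t _ => ?_
  rw [Measure.smul_apply, Measure.pi_pi, smul_eq_mul, ← Finset.prod_mul_distrib]
  simp [h]

/-- Since `γ ≤ 1`, the uniform law on `[0, γ]` has constant density `1 / γ` with respect to the
uniform law on `[0, 1]`, restricted to values at most `γ`. -/
lemma map_mul_unitInterval {γ : ℝ} (hγ0 : 0 < γ) (hγ1 : γ ≤ 1) :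
    ((volume : Measure ℝ).restrict (Set.Icc 0 1)).map (fun t => γ * t) =
      (ENNReal.ofReal γ)⁻¹ • ((volume : Measure ℝ).restrict (Set.Icc 0 1)).restrict (Set.Iic γ) := by
  have h1 : Set.Icc (0 : ℝ) 1 = (fun t => γ * t) ⁻¹' (Set.Icc 0 γ) := by
    ext t
    simp only [Set.mem_Icc, Set.mem_preimage]
    constructor
    · rintro ⟨h, h'⟩; constructor <;> nlinarith
    · rintro ⟨h, h'⟩; constructor <;> nlinarith
  have h2 : Set.Iic γ ∩ Set.Icc (0 : ℝ) 1 = Set.Icc 0 γ := by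
    ext t
    simp only [Set.mem_Icc, Set.mem_inter_iff, Set.mem_Iic]
    constructor
    · rintro ⟨h, h', h''⟩; exact ⟨h', h⟩
    · rintro ⟨h, h'⟩; exact ⟨h', h, by linarith⟩
  rw [Measure.restrict_restrict measurableSet_Iic, h2]
  conv_lhs => rw [h1]
  rw [← Measure.restrict_map (by fun_prop) measurableSet_Icc, Real.map_volume_mul_left hγ0.ne',
    Measure.restrict_smul, abs_of_pos (by positivity), ENNReal.ofReal_inv_of_pos hγ0]

/-- By disjointness at most one of the two summands is nonzero in each coordinate, so no convolution
of uniform laws occurs. -/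
lemma map_coordLaw_prod {γ : ℝ} (hγ0 : 0 < γ) (hγ1 : γ ≤ 1) {A B : Finset (Fin n)}
    (hAB : Disjoint A B) (i : Fin n) :
    ((coordLaw A i).prod (coordLaw B i)).map (fun p => p.1 + γ * p.2) =
      (if i ∈ B then (ENNReal.ofReal γ)⁻¹ else 1) •
        (coordLaw (A ∪ B) i).restrict (if i ∈ B then Set.Iic γ else Set.univ) := by
  by_cases hB : i ∈ B
  · have hA : i ∉ A := fun h => Finset.disjoint_left.1 hAB h hB
    simp only [coordLaw, hA, hB, if_true, if_false, Finset.mem_union, or_true]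
    rw [Measure.dirac_prod, Measure.map_map (by fun_prop) (by fun_prop),
      ← map_mul_unitInterval hγ0 hγ1]
    congr 1
    ext t
    simp
  · have h : coordLaw (A ∪ B) i = coordLaw A i := by simp [coordLaw, hB]
    simp only [hB, if_false, h, one_smul, Measure.restrict_univ]
    have hB' : coordLaw B i = Measure.dirac 0 := by simp [coordLaw, hB]
    rw [hB', Measure.prod_dirac, Measure.map_map (by fun_prop) (by fun_prop)]
    have hid : (fun p : ℝ × ℝ => p.1 + γ * p.2) ∘ (fun x : ℝ => (x, 0)) = id := by
      ext t
      simp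
    rw [hid, Measure.map_id]

/-- The law of `β_A + γ β_B` for signals with given disjoint supports `A` and `B`. -/
lemma map_unifLaw_prod {γ : ℝ} (hγ0 : 0 < γ) (hγ1 : γ ≤ 1) {A B : Finset (Fin n)}
    (hAB : Disjoint A B) :
    ((unifLaw A).prod (unifLaw B)).map (fun p => p.1 + γ • p.2) =
      (ENNReal.ofReal γ ^ B.card)⁻¹ • (unifLaw (A ∪ B)).restrict {w | ∀ i ∈ B, w i ≤ γ} := by
  have h1 := measurePreserving_arrowProdEquivProdArrow ℝ ℝ (Fin n) (coordLaw A) (coordLaw B)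
  rw [unifLaw, unifLaw, ← h1.map_eq, Measure.map_map (by fun_prop) h1.measurable]
  have h2 : ((fun p : (Fin n → ℝ) × (Fin n → ℝ) => p.1 + γ • p.2) ∘
      MeasurableEquiv.arrowProdEquivProdArrow ℝ ℝ (Fin n)) =
      fun x i => (fun p : ℝ × ℝ => p.1 + γ * p.2) (x i) := by
    ext x i
    rfl
  have hprob : ∀ i, IsProbabilityMeasure
      (((coordLaw A i).prod (coordLaw B i)).map (fun p : ℝ × ℝ => p.1 + γ * p.2)) :=
    fun i => Measure.isProbabilityMeasure_map (by fun_prop)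
  rw [h2, Measure.pi_map_pi (f := fun _ (p : ℝ × ℝ) => p.1 + γ * p.2) (fun i => by fun_prop),
    Measure.pi_eq_smul_pi (map_coordLaw_prod hγ0 hγ1 hAB), ← Measure.restrict_pi_pi]
  congr 1
  · rw [Finset.prod_ite_mem, Finset.univ_inter, Finset.prod_const, ENNReal.inv_pow]
  · congr 1
    ext w
    simp only [Set.mem_univ_pi, Set.mem_ofPred_eq]
    refine forall_congr' fun i => ?_
    split_ifs with h <;> simp [h]

/-- The complement is a box in which each entry indexed by `S` exceeds `γ`, independently with
probability `1 - γ`. -/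
lemma unifLaw_exists_le {γ : ℝ} (hγ0 : 0 < γ) (hγ1 : γ ≤ 1) (S : Finset (Fin n)) :
    unifLaw S {w | ∃ i ∈ S, w i ≤ γ} = ENNReal.ofReal (1 - (1 - γ) ^ S.card) := by
  have h1 : {w : Fin n → ℝ | ∃ i ∈ S, w i ≤ γ} =
      (Set.univ.pi fun i => if i ∈ S then Set.Ioi γ else Set.univ)ᶜ := by
    ext w
    simp only [Set.mem_ofPred_eq, Set.mem_compl_iff, Set.mem_univ_pi, not_forall]
    refine exists_congr fun i => ?_
    split_ifs with h <;> simp [h]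
  have hm : MeasurableSet (Set.univ.pi fun i => if i ∈ S then Set.Ioi γ else Set.univ) := by
    refine MeasurableSet.univ_pi fun i => ?_
    split_ifs
    · exact measurableSet_Ioi
    · exact MeasurableSet.univ
  have h2 : ∀ i, coordLaw S i (if i ∈ S then Set.Ioi γ else Set.univ) =
      if i ∈ S then ENNReal.ofReal (1 - γ) else 1 := by
    intro i
    split_ifs with h
    · have : Set.Ioi γ ∩ Set.Icc (0 : ℝ) 1 = Set.Ioc γ 1 := by
        ext t
        simp only [Set.mem_inter_iff, Set.mem_Ioi, Set.mem_Icc, Set.mem_Ioc]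
        exact ⟨fun h => ⟨h.1, h.2.2⟩, fun h => ⟨h.1, by linarith, h.2⟩⟩
      rw [coordLaw, if_pos h, Measure.restrict_apply measurableSet_Ioi, this, Real.volume_Ioc]
    · exact measure_univ
  rw [h1, prob_compl_eq_one_sub hm, unifLaw, Measure.pi_pi, Finset.prod_congr rfl fun i _ => h2 i,
    Finset.prod_ite_mem, Finset.univ_inter, Finset.prod_const,
    ← ENNReal.ofReal_pow (by linarith), ← ENNReal.ofReal_one,
    ← ENNReal.ofReal_sub _ (pow_nonneg (by linarith) _)]

end UniformSignals

/-! ### Candidate supports for Bob's signal given the weighted sum -/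

section Candidates

variable {n k : ℕ} {G : Type*} [AddCommGroup G]

/-- The support of a real vector. -/
def realSupport (w : Fin n → ℝ) : Finset (Fin n) := Finset.univ.filter fun i => w i ≠ 0

lemma mem_realSupport {w : Fin n → ℝ} {i : Fin n} : i ∈ realSupport w ↔ w i ≠ 0 := by
  simp [realSupport]

open Classical in
/-- The possible supports of `β_B`, given that `β_A + γ β_B = w`, if `w` has good support. -/
def candidates (e : Fin n → G) (k : ℕ) (γ : ℝ) (w : Fin n → ℝ) : Finset (Finset (Fin n)) :=
  Finset.univ.filter fun B => (realSupport w ∈ goodSets e k ∧ ∀ i, 0 ≤ w i) ∧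
    B ⊆ realSupport w ∧ B.card = k ∧ ∀ i ∈ B, w i ≤ γ

lemma mem_candidates {e : Fin n → G} {γ : ℝ} {w : Fin n → ℝ} {B : Finset (Fin n)} :
    B ∈ candidates e k γ w ↔ (realSupport w ∈ goodSets e k ∧ ∀ i, 0 ≤ w i) ∧
      B ⊆ realSupport w ∧ B.card = k ∧ ∀ i ∈ B, w i ≤ γ := by
  simp [candidates]

lemma measurableSet_forall_mem_le (B : Finset (Fin n)) (γ : ℝ) :
    MeasurableSet {w : Fin n → ℝ | ∀ i ∈ B, w i ≤ γ} := by
  have : {w : Fin n → ℝ | ∀ i ∈ B, w i ≤ γ} = ⋂ i ∈ B, {w | w i ≤ γ} := by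
    ext w; simp
  rw [this]
  exact Finset.measurableSet_biInter _ fun i _ => measurableSet_le (by fun_prop) (by fun_prop)

lemma measurableSet_mem_candidates (e : Fin n → G) (k : ℕ) (γ : ℝ) (B : Finset (Fin n)) :
    MeasurableSet {w | B ∈ candidates e k γ w} := by
  have hs : ∀ i : Fin n, MeasurableSet {w : Fin n → ℝ | i ∈ realSupport w} := by
    intro i
    simp only [mem_realSupport]
    exact (measurableSet_eq_fun (f := fun w : Fin n → ℝ => w i) (by fun_prop)
      measurable_const).compl
  have h1 : MeasurableSet {w : Fin n → ℝ | realSupport w ∈ goodSets e k ∧ B ⊆ realSupport w} :=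
    measurableSet_setOfPred.2 (measurable_comp_finset hs fun S => S ∈ goodSets e k ∧ B ⊆ S)
  have h2 : MeasurableSet {w : Fin n → ℝ | ∀ i, 0 ≤ w i} := by
    have : {w : Fin n → ℝ | ∀ i, 0 ≤ w i} = ⋂ i, {w | 0 ≤ w i} := by
      ext w; simp
    rw [this]
    exact MeasurableSet.iInter fun i => measurableSet_le (by fun_prop) (by fun_prop)
  have h3 : {w | B ∈ candidates e k γ w} =
      ({w : Fin n → ℝ | realSupport w ∈ goodSets e k ∧ B ⊆ realSupport w} ∩
        {w : Fin n → ℝ | ∀ i, 0 ≤ w i}) ∩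
        ({_w : Fin n → ℝ | B.card = k} ∩ {w : Fin n → ℝ | ∀ i ∈ B, w i ≤ γ}) := by
    ext w
    simp only [mem_candidates, Set.mem_ofPred_eq, Set.mem_inter_iff]
    tauto
  rw [h3]
  exact (h1.inter h2).inter ((MeasurableSet.const _).inter (measurableSet_forall_mem_le B γ))

/-- The restriction of `w` to the complement of `B`. -/
def alicePart (B : Finset (Fin n)) (w : Fin n → ℝ) : Fin n → ℝ := fun i => if i ∈ B then 0 else w i

/-- The restriction of `w / γ` to `B`. -/
def bobPart (γ : ℝ) (B : Finset (Fin n)) (w : Fin n → ℝ) : Fin n → ℝ :=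
  fun i => if i ∈ B then γ⁻¹ * w i else 0

lemma measurable_alicePart (B : Finset (Fin n)) : Measurable (alicePart B) := by
  refine measurable_pi_lambda _ fun i => ?_
  unfold alicePart
  split_ifs <;> fun_prop

lemma measurable_bobPart (γ : ℝ) (B : Finset (Fin n)) : Measurable (bobPart γ B) := by
  refine measurable_pi_lambda _ fun i => ?_
  unfold bobPart
  split_ifs <;> fun_prop

lemma alicePart_add_bobPart {γ : ℝ} (hγ : γ ≠ 0) (B : Finset (Fin n)) (w : Fin n → ℝ) :
    alicePart B w + γ • bobPart γ B w = w := by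
  ext i
  by_cases h : i ∈ B <;> simp [alicePart, bobPart, h, hγ]

lemma realSupport_of_ae {S : Finset (Fin n)} {w : Fin n → ℝ}
    (h : ∀ i, (i ∈ S → 0 < w i ∧ w i ≤ 1) ∧ (i ∉ S → w i = 0)) : realSupport w = S := by
  ext i
  rw [mem_realSupport]
  by_cases hi : i ∈ S
  · simp [hi, ((h i).1 hi).1.ne']
  · simp [hi, (h i).2 hi]

lemma nonneg_of_ae {S : Finset (Fin n)} {w : Fin n → ℝ}
    (h : ∀ i, (i ∈ S → 0 < w i ∧ w i ≤ 1) ∧ (i ∉ S → w i = 0)) (i : Fin n) : 0 ≤ w i := by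
  by_cases hi : i ∈ S
  · exact ((h i).1 hi).1.le
  · exact ((h i).2 hi).ge

/-- Almost surely `w` is nonnegative with support `S`, so being a candidate reduces to the condition
`w ≤ γ` on `B`. -/
lemma lintegral_unifLaw_candidates {e : Fin n → G} {γ : ℝ} {S : Finset (Fin n)}
    (hS : S ∈ goodSets e k) {f : Finset (Fin n) → (Fin n → ℝ) → ℝ≥0∞} (hf : ∀ B, Measurable (f B)) :
    ∫⁻ w, ∑ B ∈ candidates e k γ w, f B w ∂(unifLaw S) =
      ∑ B ∈ Finset.powersetCard k S, ∫⁻ w in {w | ∀ i ∈ B, w i ≤ γ}, f B w ∂(unifLaw S) := by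
  have h1 : ∀ B, ∫⁻ w in {w | ∀ i ∈ B, w i ≤ γ}, f B w ∂(unifLaw S) =
      ∫⁻ w, {w | ∀ i ∈ B, w i ≤ γ}.indicator (f B) w ∂(unifLaw S) := fun B =>
    (lintegral_indicator (measurableSet_forall_mem_le B γ) _).symm
  simp only [h1]
  rw [← lintegral_finsetSum _ fun B _ => (hf B).indicator (measurableSet_forall_mem_le B γ)]
  refine lintegral_congr_ae ?_
  filter_upwards [ae_unifLaw S] with w hw
  have hc : candidates e k γ w = (Finset.powersetCard k S).filter fun B => ∀ i ∈ B, w i ≤ γ := by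
    ext B
    simp only [mem_candidates, realSupport_of_ae hw, hS, nonneg_of_ae hw, Finset.mem_filter,
      Finset.mem_powersetCard]
    tauto
  rw [hc, Finset.sum_filter]
  refine Finset.sum_congr rfl fun B _ => ?_
  simp [Set.indicator]

variable {γ : ℝ}

lemma realSupport_add {A B : Finset (Fin n)} (hγ0 : 0 < γ) {x y : Fin n → ℝ}
    (hx : ∀ i, (i ∈ A → 0 < x i ∧ x i ≤ 1) ∧ (i ∉ A → x i = 0))
    (hy : ∀ i, (i ∈ B → 0 < y i ∧ y i ≤ 1) ∧ (i ∉ B → y i = 0)) :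
    realSupport (x + γ • y) = A ∪ B := by
  ext i
  rw [mem_realSupport, Finset.mem_union, Pi.add_apply, Pi.smul_apply, smul_eq_mul]
  have hx0 := nonneg_of_ae hx i
  have hy0 := mul_nonneg hγ0.le (nonneg_of_ae hy i)
  by_cases hA : i ∈ A
  · have := ((hx i).1 hA).1
    simp only [hA, true_or, iff_true]
    linarith
  by_cases hB : i ∈ B
  · have := mul_pos hγ0 ((hy i).1 hB).1
    simp only [hB, or_true, iff_true]
    linarith
  · simp [hA, hB, (hx i).2 hA, (hy i).2 hB]

lemma ae_prod_unifLaw (A B : Finset (Fin n)) : ∀ᵐ p ∂((unifLaw A).prod (unifLaw B)),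
    (∀ i, (i ∈ A → 0 < p.1 i ∧ p.1 i ≤ 1) ∧ (i ∉ A → p.1 i = 0)) ∧
      (∀ i, (i ∈ B → 0 < p.2 i ∧ p.2 i ≤ 1) ∧ (i ∉ B → p.2 i = 0)) :=
  (Measure.quasiMeasurePreserving_fst.ae (ae_unifLaw A)).and
    (Measure.quasiMeasurePreserving_snd.ae (ae_unifLaw B))

lemma lintegral_prod_of_union_notMem {e : Fin n → G} (hγ0 : 0 < γ)
    {A B : Finset (Fin n)} (h : A ∪ B ∉ goodSets e k)
    (f : (Fin n → ℝ) × (Fin n → ℝ) → ℝ≥0∞) :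
    ∫⁻ p, {p | (candidates e k γ (p.1 + γ • p.2)).Nonempty}.indicator f p
      ∂((unifLaw A).prod (unifLaw B)) = 0 := by
  rw [lintegral_eq_zero_of_ae_eq_zero]
  filter_upwards [ae_prod_unifLaw A B] with p hp
  refine Set.indicator_of_notMem ?_ _
  rintro ⟨B', hB'⟩
  rw [mem_candidates, realSupport_add hγ0 hp.1 hp.2] at hB'
  exact h hB'.1.1

/-- Change of variables to `w = x + γ y`. As the supports are disjoint, `w` and `B` give back both
signals, and `B` itself is a candidate, so the indicator is almost surely 1. -/
lemma lintegral_prod_of_union_mem {e : Fin n → G} (hγ0 : 0 < γ) (hγ1 : γ ≤ 1)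
    {A B : Finset (Fin n)} (hA : A.card = k) (hB : B.card = k) (h : A ∪ B ∈ goodSets e k)
    {f : (Fin n → ℝ) × (Fin n → ℝ) → ℝ≥0∞} (hf : Measurable f) :
    ∫⁻ p, {p | (candidates e k γ (p.1 + γ • p.2)).Nonempty}.indicator f p
        ∂((unifLaw A).prod (unifLaw B)) =
      (ENNReal.ofReal γ ^ k)⁻¹ * ∫⁻ w in {w | ∀ i ∈ B, w i ≤ γ},
        f (alicePart B w, bobPart γ B w) ∂(unifLaw (A ∪ B)) := by
  have hdisj := disjoint_of_union_mem_goodSets hA hB h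
  have hm : Measurable fun w => f (alicePart B w, bobPart γ B w) :=
    hf.comp ((measurable_alicePart B).prodMk (measurable_bobPart γ B))
  rw [← smul_eq_mul, ← lintegral_smul_measure, ← hB, ← map_unifLaw_prod hγ0 hγ1 hdisj,
    lintegral_map hm (by fun_prop)]
  refine lintegral_congr_ae ?_
  filter_upwards [ae_prod_unifLaw A B] with p hp
  have hsub : ∀ i ∈ B, p.1 i = 0 := fun i hi =>
    (hp.1 i).2 fun hA => Finset.disjoint_left.1 hdisj hA hi
  rw [Set.indicator_of_mem]
  · congr 1
    refine Prod.ext ?_ ?_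
    · ext i
      by_cases hi : i ∈ B
      · simp [alicePart, hi, hsub i hi]
      · simp [alicePart, hi, (hp.2 i).2 hi]
    · ext i
      by_cases hi : i ∈ B
      · simp [bobPart, hi, hsub i hi, hγ0.ne']
      · simp [bobPart, hi, (hp.2 i).2 hi]
  · refine ⟨B, ?_⟩
    rw [mem_candidates, realSupport_add hγ0 hp.1 hp.2]
    refine ⟨⟨by rwa [hB], fun i => ?_⟩, Finset.subset_union_right, rfl, fun i hi => ?_⟩
    · exact add_nonneg (nonneg_of_ae hp.1 i) (mul_nonneg hγ0.le (nonneg_of_ae hp.2 i))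
    · have := ((hp.2 i).1 hi).2
      simp only [Pi.add_apply, Pi.smul_apply, smul_eq_mul, hsub i hi]
      nlinarith

/-- Comparison of total masses in `map_unifLaw_prod`. -/
lemma unifLaw_forall_le (hγ0 : 0 < γ) (hγ1 : γ ≤ 1) {A B : Finset (Fin n)} (h : Disjoint A B) :
    (ENNReal.ofReal γ ^ B.card)⁻¹ * unifLaw (A ∪ B) {w | ∀ i ∈ B, w i ≤ γ} = 1 := by
  have h1 := congrArg (fun μ => μ Set.univ) (map_unifLaw_prod hγ0 hγ1 h)
  have hprob : IsProbabilityMeasure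
      (((unifLaw A).prod (unifLaw B)).map (fun p => p.1 + γ • p.2)) :=
    Measure.isProbabilityMeasure_map (by fun_prop)
  simp only [measure_univ, Measure.smul_apply, Measure.restrict_apply_univ, smul_eq_mul] at h1
  exact h1.symm

/-- Regroups pairs by what the eavesdropper sees, through the bijection `(A, B) ↔ (A ∪ B, B)` with
inverse `(S, B) ↦ (S \ B, B)`. -/
lemma sum_subsetPairs_good {M : Type*} [AddCommMonoid M] (e : Fin n → G) (k : ℕ)
    (g : Finset (Fin n) → Finset (Fin n) → M) :
    ∑ p ∈ (subsetPairs n k).filter (fun p => p.1 ∪ p.2 ∈ goodSets e k), g (p.1 ∪ p.2) p.2 =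
      ∑ S ∈ goodSets e k, ∑ B ∈ Finset.powersetCard k S, g S B := by
  rw [Finset.sum_sigma']
  refine Finset.sum_bij' (fun p _ => ⟨p.1 ∪ p.2, p.2⟩) (fun q _ => (q.1 \ q.2, q.2)) ?_ ?_ ?_ ?_ ?_
  · rintro ⟨A, B⟩ h
    simp only [Finset.mem_filter, subsetPairs, Finset.mem_product, Finset.mem_powersetCard] at h
    simp only [Finset.mem_sigma, Finset.mem_powersetCard]
    exact ⟨h.2, Finset.subset_union_right, h.1.2.2⟩
  · rintro ⟨S, B⟩ h
    simp only [Finset.mem_sigma, Finset.mem_powersetCard] at h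
    simp only [Finset.mem_filter, subsetPairs, Finset.mem_product, Finset.mem_powersetCard,
      Finset.sdiff_union_of_subset h.2.1, Finset.subset_univ, true_and]
    refine ⟨⟨?_, h.2.2⟩, h.1⟩
    rw [Finset.card_sdiff_of_subset h.2.1, h.2.2, (mem_goodSets.1 h.1).1]
    omega
  · rintro ⟨A, B⟩ h
    simp only [Finset.mem_filter, subsetPairs, Finset.mem_product, Finset.mem_powersetCard] at h
    have hd := disjoint_of_union_mem_goodSets h.1.1.2 h.1.2.2 h.2
    simp only [Prod.mk.injEq, and_true]
    exact Finset.union_sdiff_cancel_right hd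
  · rintro ⟨S, B⟩ h
    simp only [Finset.mem_sigma, Finset.mem_powersetCard] at h
    simp [Finset.sdiff_union_of_subset h.2.1]
  · intro p _
    rfl

lemma card_goodPairs (e : Fin n → G) (k : ℕ) :
    ((subsetPairs n k).filter fun p => p.1 ∪ p.2 ∈ goodSets e k).card =
      (goodSets e k).card * (2 * k).choose k := by
  rw [Finset.card_eq_sum_ones, sum_subsetPairs_good e k fun _ _ => 1, Finset.sum_congr rfl]
  · rw [Finset.sum_const, smul_eq_mul]
  · intro S hS
    rw [← Finset.card_eq_sum_ones, Finset.card_powersetCard, (mem_goodSets.1 hS).1]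

/-- The joint law of the two signals, on the event that there are candidates. -/
lemma sum_lintegral_subsetPairs (e : Fin n → G) (k : ℕ) (hγ0 : 0 < γ) (hγ1 : γ ≤ 1)
    {f : (Fin n → ℝ) × (Fin n → ℝ) → ℝ≥0∞} (hf : Measurable f) :
    ∑ p ∈ subsetPairs n k, ∫⁻ q, {q | (candidates e k γ (q.1 + γ • q.2)).Nonempty}.indicator f q
        ∂((unifLaw p.1).prod (unifLaw p.2)) =
      (ENNReal.ofReal γ ^ k)⁻¹ * ∑ S ∈ goodSets e k,
        ∫⁻ w, ∑ B ∈ candidates e k γ w, f (alicePart B w, bobPart γ B w) ∂(unifLaw S) := by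
  rw [← Finset.sum_filter_add_sum_filter_not _ fun p => p.1 ∪ p.2 ∈ goodSets e k,
    Finset.sum_eq_zero (s := (subsetPairs n k).filter fun p => ¬ p.1 ∪ p.2 ∈ goodSets e k)
      fun p hp => lintegral_prod_of_union_notMem hγ0 (Finset.mem_filter.1 hp).2 f, add_zero,
    Finset.mul_sum]
  have h1 : ∀ S ∈ goodSets e k, (ENNReal.ofReal γ ^ k)⁻¹ *
      ∫⁻ w, ∑ B ∈ candidates e k γ w, f (alicePart B w, bobPart γ B w) ∂(unifLaw S) =
      ∑ B ∈ Finset.powersetCard k S, (ENNReal.ofReal γ ^ k)⁻¹ *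
        ∫⁻ w in {w | ∀ i ∈ B, w i ≤ γ}, f (alicePart B w, bobPart γ B w) ∂(unifLaw S) := by
    intro S hS
    rw [lintegral_unifLaw_candidates (f := fun B w => f (alicePart B w, bobPart γ B w)) hS fun B =>
      hf.comp ((measurable_alicePart B).prodMk (measurable_bobPart γ B)), Finset.mul_sum]
  rw [Finset.sum_congr rfl h1, ← sum_subsetPairs_good e k fun S B => (ENNReal.ofReal γ ^ k)⁻¹ *
    ∫⁻ w in {w | ∀ i ∈ B, w i ≤ γ}, f (alicePart B w, bobPart γ B w) ∂(unifLaw S)]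
  refine Finset.sum_congr rfl fun p hp => ?_
  simp only [Finset.mem_filter, subsetPairs, Finset.mem_product, Finset.mem_powersetCard] at hp
  exact lintegral_prod_of_union_mem hγ0 hγ1 hp.1.1.2 hp.1.2.2 hp.2 hf

/-- Candidates exist almost surely when the union of the supports is good and almost never
otherwise. -/
lemma sum_prod_unifLaw_candidates (e : Fin n → G) (k : ℕ) (hγ0 : 0 < γ) (hγ1 : γ ≤ 1) :
    ∑ p ∈ subsetPairs n k, ∫⁻ q, {q | (candidates e k γ (q.1 + γ • q.2)).Nonempty}.indicator 1 q
        ∂((unifLaw p.1).prod (unifLaw p.2)) =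
      ((subsetPairs n k).filter fun p => p.1 ∪ p.2 ∈ goodSets e k).card := by
  rw [← Finset.sum_filter_add_sum_filter_not _ fun p => p.1 ∪ p.2 ∈ goodSets e k,
    Finset.sum_eq_zero (s := (subsetPairs n k).filter fun p => ¬ p.1 ∪ p.2 ∈ goodSets e k)
      fun p hp => lintegral_prod_of_union_notMem hγ0 (Finset.mem_filter.1 hp).2 1, add_zero,
    Finset.card_eq_sum_ones]
  push_cast
  refine Finset.sum_congr rfl fun p hp => ?_
  simp only [Finset.mem_filter, subsetPairs, Finset.mem_product, Finset.mem_powersetCard] at hp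
  rw [lintegral_prod_of_union_mem hγ0 hγ1 hp.1.1.2 hp.1.2.2 hp.2 measurable_one]
  have := unifLaw_forall_le hγ0 hγ1 (disjoint_of_union_mem_goodSets hp.1.1.2 hp.1.2.2 hp.2)
  rw [hp.1.2.2] at this
  simpa using this

/-- A candidate is nonempty since `k > 0`, so some entry on `S` is at most `γ`. -/
lemma unifLaw_candidates_nonempty_le (e : Fin n → G) (hk : 0 < k) (hγ0 : 0 < γ) (hγ1 : γ ≤ 1)
    {S : Finset (Fin n)} (hS : S ∈ goodSets e k) :
    unifLaw S {w | (candidates e k γ w).Nonempty} ≤ ENNReal.ofReal (1 - (1 - γ) ^ (2 * k)) := by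
  rw [← (mem_goodSets.1 hS).1, ← unifLaw_exists_le hγ0 hγ1 S]
  refine measure_mono_ae ?_
  filter_upwards [ae_unifLaw S] with w hw
  rintro ⟨B, hB⟩
  rw [mem_candidates, realSupport_of_ae hw] at hB
  obtain ⟨i, hi⟩ := Finset.card_pos.1 (hB.2.2.1 ▸ hk)
  exact ⟨i, hB.2.1 hi, hB.2.2.2 i hi⟩

end Candidates

/-! ### The eavesdropper's uncertainty for a fixed channel -/

section Eavesdropper

variable {n m k : ℕ}

lemma lintegral_signalLaw_prod [SFinite (signalLaw n k)] {f : (Fin n → ℂ) × (Fin n → ℂ) → ℝ≥0∞}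
    (hf : Measurable f) :
    ∫⁻ p, f p ∂((signalLaw n k).prod (signalLaw n k)) = ((n.choose k : ℝ≥0∞)⁻¹) ^ 2 *
      ∑ p ∈ subsetPairs n k, ∫⁻ q, f (toComplex q.1, toComplex q.2)
        ∂((unifLaw p.1).prod (unifLaw p.2)) := by
  have h1 : ∀ {g : (Fin n → ℂ) → ℝ≥0∞}, Measurable g → ∫⁻ a, g a ∂(signalLaw n k) =
      (n.choose k : ℝ≥0∞)⁻¹ * ∑ A ∈ Finset.powersetCard k Finset.univ,
        ∫⁻ x, g (toComplex x) ∂(unifLaw A) := by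
    intro g hg
    rw [signalLaw_eq, lintegral_smul_measure, lintegral_finsetSum_measure, smul_eq_mul]
    congr 1
    exact Finset.sum_congr rfl fun A _ => lintegral_map hg measurable_toComplex
  have hf' : Measurable fun q : (Fin n → ℝ) × (Fin n → ℝ) => f (toComplex q.1, toComplex q.2) :=
    hf.comp ((measurable_toComplex.comp measurable_fst).prodMk
      (measurable_toComplex.comp measurable_snd))
  rw [lintegral_prod _ hf.aemeasurable, h1 hf.lintegral_prod_right', subsetPairs,
    Finset.sum_product, sq, mul_assoc]
  congr 1
  rw [Finset.mul_sum]
  refine Finset.sum_congr rfl fun A _ => ?_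
  have h2 : ∀ x, ∫⁻ y, f (toComplex x, y) ∂(signalLaw n k) =
      (n.choose k : ℝ≥0∞)⁻¹ * ∑ B ∈ Finset.powersetCard k Finset.univ,
        ∫⁻ y, f (toComplex x, toComplex y) ∂(unifLaw B) := fun x =>
    h1 (hf.comp measurable_prodMk_left)
  simp only [h2]
  rw [lintegral_const_mul, lintegral_finsetSum]
  · congr 1
    refine Finset.sum_congr rfl fun B _ => ?_
    rw [lintegral_prod _ hf'.aemeasurable]
  · exact fun B _ => hf'.lintegral_prod_right'
  · exact Finset.measurable_fun_sum _ fun B _ => hf'.lintegral_prod_right'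

/-- The vector `v` recovered from `h ⊗ v`, where `h i ≠ 0`. -/
def decode (h : Fin m → ℂ) (i : Fin m) (y : Fin m → Fin n → ℂ) : Fin n → ℝ :=
  fun j => (y i j / h i).re

lemma measurable_decode (h : Fin m → ℂ) (i : Fin m) :
    Measurable (decode h i : (Fin m → Fin n → ℂ) → Fin n → ℝ) := by
  unfold decode
  fun_prop

lemma decode_tensor {h : Fin m → ℂ} {i : Fin m} (hi : h i ≠ 0) (w : Fin n → ℝ) :
    decode h i (tensor h (toComplex w)) = w := by
  ext j
  simp [decode, tensor, toComplex, mul_div_cancel_left₀ _ hi]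

lemma measurable_tensor (h : Fin m → ℂ) :
    Measurable (tensor h : (Fin n → ℂ) → Fin m → Fin n → ℂ) := by
  unfold tensor
  fun_prop

lemma toComplex_add_smul (x y : Fin n → ℝ) (γ : ℝ) :
    toComplex x + (γ : ℂ) • toComplex y = toComplex (x + γ • y) := by
  ext i
  simp [toComplex]

variable [NeZero n] [NeZero m]

lemma measurable_secret {Z : Type*} [MeasurableSpace Z] (h : Fin m → ℂ) {f g : Z → Fin n → ℂ}
    (hf : Measurable f) (hg : Measurable g) : Measurable fun z => secret h (f z) (g z) := by
  refine measurable_pi_lambda _ fun j => ?_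
  simp only [secret, Pi.mul_apply, dft_liftSignal]
  fun_prop

/-- The secret of two signals with sum `w = β_A + γ β_B`, when `B` is the support of `β_B`. -/
def candidateSecret (h : Fin m → ℂ) (γ : ℝ) (B : Finset (Fin n)) (w : Fin n → ℝ) :
    ZMod (n * m) → ℂ :=
  secret h (toComplex (alicePart B w)) (toComplex (bobPart γ B w))

lemma measurable_candidateSecret (h : Fin m → ℂ) (γ : ℝ) (B : Finset (Fin n)) :
    Measurable (candidateSecret h γ B) :=
  measurable_secret h (measurable_toComplex.comp (measurable_alicePart B))
    (measurable_toComplex.comp (measurable_bobPart γ B))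

lemma exists_ne_zero_of_dft {h : Fin m → ℂ} (hh : ∀ j, ZMod.dft (liftChannel n h) j ≠ 0) :
    ∃ i, h i ≠ 0 := by
  by_contra! hcon
  refine hh 0 ?_
  rw [dft_liftChannel]
  simp [hcon]

/-- Given `w = β_A + γ β_B` with good support, the secret determines the support of `β_B` up to
complement in the support of `w`. -/
lemma card_filter_secret_eq_le_two {h : Fin m → ℂ}
    (hh : ∀ j, ZMod.dft (liftChannel n h) j ≠ 0) (hk : 0 < k) {γ : ℝ} (hγ0 : 0 < γ)
    (w : Fin n → ℝ) [DecidableEq (ZMod (n * m) → ℂ)] {B : Finset (Fin n)}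
    (hB : B ∈ candidates (position n m) k γ w) :
    ((candidates (position n m) k γ w).filter fun B' =>
      candidateSecret h γ B' w = candidateSecret h γ B w).card ≤ 2 := by
  have hsub : ((candidates (position n m) k γ w).filter fun B' =>
      candidateSecret h γ B' w = candidateSecret h γ B w) ⊆
      {B, realSupport w \ B} := by
    intro B' hB'
    rw [Finset.mem_filter] at hB'
    obtain ⟨hB', heq⟩ := hB'
    rw [mem_candidates] at hB hB'
    have hS := mem_goodSets.1 hB.1.1
    rw [Finset.mem_insert, Finset.mem_singleton]
    refine eq_or_eq_sdiff_of_sums hS.2 position_injective hB.2.1 hB'.2.1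
      (Finset.card_pos.1 (by omega)) (Finset.card_pos.1 ?_) ?_
    · rw [Finset.card_sdiff_of_subset hB.2.1]
      omega
    · intro a ha b hb
      rw [Finset.mem_sdiff, mem_realSupport] at ha
      have hx : 0 ≤ alicePart B w := by
        intro i
        simp only [alicePart, Pi.zero_apply]
        split_ifs
        · exact le_rfl
        · exact hB.1.2 i
      have hy : 0 ≤ bobPart γ B w := by
        intro i
        simp only [bobPart, Pi.zero_apply]
        split_ifs
        · exact mul_nonneg (by positivity) (hB.1.2 i)
        · exact le_rfl
      have hxa : alicePart B w a ≠ 0 := by simpa [alicePart, ha.2] using ha.1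
      have hyb : bobPart γ B w b ≠ 0 := by
        simpa [bobPart, hb, hγ0.ne'] using mem_realSupport.1 (hB.2.1 hb)
      obtain ⟨a', b', ha', hb', hsum⟩ := exists_position_add_eq hh hx hy heq.symm hxa hyb
      refine ⟨a', ?_, b', ?_, hsum⟩
      · rw [Finset.mem_sdiff, mem_realSupport]
        constructor
        · intro h0
          simp [alicePart, h0] at ha'
        · intro h0
          simp [alicePart, h0] at ha'
      · by_contra h0
        simp [bobPart, h0] at hb'
  exact (Finset.card_le_card hsub).trans Finset.card_le_two

variable {Ω : Type*} [MeasurableSpace Ω] {P : Measure Ω} [IsProbabilityMeasure P]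
  {βA βB : Ω → Fin n → ℂ}

/-- Conditional law of the secret given the eavesdropper's knowledge, on the event that there are
candidates. -/
lemma setLIntegral_map_tensor_secret {h : Fin m → ℂ} {i : Fin m} (hi : h i ≠ 0) {γ : ℝ}
    (hA : HasLaw βA (signalLaw n k) P) (hB : HasLaw βB (signalLaw n k) P) (hAB : IndepFun βA βB P)
    {f : (Fin m → Fin n → ℂ) × (ZMod (n * m) → ℂ) → ℝ≥0∞} (hf : Measurable f) :
    ∫⁻ z in {z | (candidates (position n m) k γ (decode h i z.1)).Nonempty}, f z
        ∂(P.map fun ω => (tensor h (βA ω + (γ : ℂ) • βB ω), secret h (βA ω) (βB ω))) =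
      ((n.choose k : ℝ≥0∞)⁻¹) ^ 2 * ∑ p ∈ subsetPairs n k,
        ∫⁻ q, {q | (candidates (position n m) k γ (q.1 + γ • q.2)).Nonempty}.indicator
          (fun q => f (tensor h (toComplex (q.1 + γ • q.2)),
            secret h (toComplex q.1) (toComplex q.2))) q ∂((unifLaw p.1).prod (unifLaw p.2)) := by
  have hsig : SFinite (signalLaw n k) := by
    rw [← hA.map_eq]
    infer_instance
  have hlaw := (IndepFun.hasLaw_prod hA hB hAB).map_eq
  have hN : MeasurableSet {z : (Fin m → Fin n → ℂ) × (ZMod (n * m) → ℂ) |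
      (candidates (position n m) k γ (decode h i z.1)).Nonempty} := by
    have h1 := measurableSet_setOfPred.2 (measurable_comp_finset
      (measurableSet_mem_candidates (position n m) k γ) fun s => s.Nonempty)
    exact ((measurable_decode h i).comp measurable_fst) h1
  have hΨ : Measurable fun p : (Fin n → ℂ) × (Fin n → ℂ) =>
      (tensor h (p.1 + (γ : ℂ) • p.2), secret h p.1 p.2) :=
    ((measurable_tensor h).comp (by fun_prop)).prodMk (measurable_secret h measurable_fst measurable_snd)
  have hmap : P.map (fun ω => (tensor h (βA ω + (γ : ℂ) • βB ω), secret h (βA ω) (βB ω))) =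
      ((signalLaw n k).prod (signalLaw n k)).map
        fun p => (tensor h (p.1 + (γ : ℂ) • p.2), secret h p.1 p.2) := by
    rw [← hlaw, AEMeasurable.map_map_of_aemeasurable hΨ.aemeasurable
      (hA.aemeasurable.prodMk hB.aemeasurable)]
    rfl
  rw [hmap, ← lintegral_indicator hN, lintegral_map (hf.indicator hN) hΨ,
    lintegral_signalLaw_prod (f := fun p => Set.indicator _ f
      (tensor h (p.1 + (γ : ℂ) • p.2), secret h p.1 p.2)) ((hf.indicator hN).comp hΨ)]
  simp only [toComplex_add_smul]
  congr 1
  refine Finset.sum_congr rfl fun p _ => lintegral_congr fun q => ?_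
  simp only [Set.indicator, Set.mem_ofPred_eq, decode_tensor hi]

/-- The entropy bound for a fixed channel without spectral zeros. -/
lemma le_condPointEntropy_secret {h : Fin m → ℂ} (hh : ∀ j, ZMod.dft (liftChannel n h) j ≠ 0)
    (hk : 0 < k) (hkn : k ≤ n) {γ : ℝ} (hγ0 : 0 < γ) (hγ1 : γ ≤ 1) {b : ℝ} (hb : 2 ≤ b)
    (hA : HasLaw βA (signalLaw n k) P) (hB : HasLaw βB (signalLaw n k) P)
    (hAB : IndepFun βA βB P) {t : ℝ}
    (ht : t = ((2 * k).choose k : ℝ)⁻¹ * ((1 - (1 - γ) ^ (2 * k)) / γ ^ k)) (ht0 : 0 < t) :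
    ENNReal.ofReal (-Real.logb b t - 1) * ENNReal.ofReal (1 - 17 * (k : ℝ) ^ 4 / n) ≤
      condPointEntropy b (fun ω => secret h (βA ω) (βB ω))
        (fun ω => tensor h (βA ω + (γ : ℂ) • βB ω)) P := by
  classical
  obtain ⟨i, hi⟩ := exists_ne_zero_of_dft hh
  set e := position n m
  set V : Ω → Fin m → Fin n → ℂ := fun ω => tensor h (βA ω + (γ : ℂ) • βB ω)
  set U : Ω → ZMod (n * m) → ℂ := fun ω => secret h (βA ω) (βB ω)
  have hV : AEMeasurable V P := (measurable_tensor h).comp_aemeasurable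
    (hA.aemeasurable.add (hB.aemeasurable.const_smul (γ : ℂ)))
  have hU : AEMeasurable U P := (measurable_secret h measurable_fst measurable_snd).comp_aemeasurable
    (f := fun ω => (βA ω, βB ω)) (hA.aemeasurable.prodMk hB.aemeasurable)
  set C : (Fin m → Fin n → ℂ) → Finset (Finset (Fin n)) :=
    fun y => candidates e k γ (decode h i y) with hCdef
  have hC : ∀ B, MeasurableSet {y | B ∈ C y} := fun B =>
    measurable_decode h i (measurableSet_mem_candidates e k γ B)
  set F : Finset (Fin n) → (Fin m → Fin n → ℂ) → ZMod (n * m) → ℂ :=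
    fun B y => candidateSecret h γ B (decode h i y) with hFdef
  have hF : ∀ B, Measurable (F B) := fun B =>
    (measurable_candidateSecret h γ B).comp (measurable_decode h i)
  have henc : Measurable fun w : Fin n → ℝ => tensor h (toComplex w) :=
    (measurable_tensor h).comp measurable_toComplex
  set M : ℝ≥0∞ := ((n.choose k : ℝ≥0∞)⁻¹) ^ 2 with hM
  -- The common weight of all candidates: `M` is the probability of a given pair of supports and
  -- `γ⁻ᵏ` is the density of `w` given that pair.
  set l : Measure (Fin m → Fin n → ℂ) := (M * (ENNReal.ofReal γ ^ k)⁻¹) •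
    ∑ S ∈ goodSets e k, (unifLaw S).map fun w => tensor h (toComplex w) with hl
  have hlint : ∀ g : (Fin m → Fin n → ℂ) → ℝ≥0∞, Measurable g → ∫⁻ y, g y ∂l =
      M * ((ENNReal.ofReal γ ^ k)⁻¹ *
        ∑ S ∈ goodSets e k, ∫⁻ w, g (tensor h (toComplex w)) ∂(unifLaw S)) := by
    intro g hg
    rw [hl, lintegral_smul_measure, lintegral_finsetSum_measure, smul_eq_mul, mul_assoc]
    congr 2
    exact Finset.sum_congr rfl fun S _ => lintegral_map hg henc
  have hlaw : ∀ f : (Fin m → Fin n → ℂ) × (ZMod (n * m) → ℂ) → ℝ≥0∞, Measurable f →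
      ∫⁻ z in {z | (C z.1).Nonempty}, f z ∂(P.map fun ω => (V ω, U ω)) =
        ∫⁻ y, ∑ B ∈ C y, f (y, F B y) ∂l := by
    intro f hf
    have hsum : Measurable fun y => ∑ B ∈ C y, f (y, F B y) := by
      have : (fun y => ∑ B ∈ C y, f (y, F B y)) =
          fun y => ∑ B, {y | B ∈ C y}.indicator (fun y => f (y, F B y)) y := by
        ext y
        simp [Set.indicator, Finset.sum_ite_mem]
      rw [this]
      exact Finset.measurable_fun_sum _ fun B _ =>
        (hf.comp (measurable_id.prodMk (hF B))).indicator (hC B)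
    have hf' : Measurable fun q : (Fin n → ℝ) × (Fin n → ℝ) =>
        f (tensor h (toComplex (q.1 + γ • q.2)), secret h (toComplex q.1) (toComplex q.2)) :=
      hf.comp ((henc.comp (by fun_prop)).prodMk (measurable_secret h
        (measurable_toComplex.comp measurable_fst) (measurable_toComplex.comp measurable_snd)))
    rw [hlint _ hsum]
    refine (setLIntegral_map_tensor_secret hi hA hB hAB hf).trans ?_
    rw [sum_lintegral_subsetPairs e k hγ0 hγ1 hf']
    simp only [hM, hCdef, hFdef, candidateSecret, decode_tensor hi, alicePart_add_bobPart hγ0.ne']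
  have htwo : ∀ᵐ y ∂l, ∀ B ∈ C y, ((C y).filter fun B' => F B' y = F B y).card ≤ 2 :=
    Filter.Eventually.of_forall fun y B hB => card_filter_secret_eq_le_two hh hk hγ0 _ hB
  have hchoose : (0 : ℝ) < n.choose k := by exact_mod_cast Nat.choose_pos hkn
  have hchoose' : (0 : ℝ) < (2 * k).choose k := by
    exact_mod_cast Nat.choose_pos (by omega)
  have hMr : M = ENNReal.ofReal (((n.choose k : ℝ)⁻¹) ^ 2) := by
    rw [hM, ENNReal.ofReal_pow (by positivity), ENNReal.ofReal_inv_of_pos hchoose,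
      ENNReal.ofReal_natCast]
  have hN : MeasurableSet {y | (C y).Nonempty} :=
    measurableSet_setOfPred.2 (measurable_comp_finset hC fun s => s.Nonempty)
  have hVN : P.map V {y | (C y).Nonempty} = ENNReal.ofReal (((n.choose k : ℝ)⁻¹) ^ 2 *
      ((subsetPairs n k).filter fun p => p.1 ∪ p.2 ∈ goodSets e k).card) := by
    have h1 : P.map V = (P.map fun ω => (V ω, U ω)).map Prod.fst :=
      (AEMeasurable.map_map_of_aemeasurable measurable_fst.aemeasurable (hV.prodMk hU)).symm
    rw [h1, Measure.map_apply measurable_fst hN, ENNReal.ofReal_mul (by positivity), ← hMr,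
      ENNReal.ofReal_natCast, ← sum_prod_unifLaw_candidates e k hγ0 hγ1, ← setLIntegral_one]
    exact setLIntegral_map_tensor_secret hi hA hB hAB measurable_one
  have hlN : l {y | (C y).Nonempty} ≤ ENNReal.ofReal (((n.choose k : ℝ)⁻¹) ^ 2 *
      ((γ ^ k)⁻¹ * ((goodSets e k).card * (1 - (1 - γ) ^ (2 * k))))) := by
    have h1 : ∀ S ∈ goodSets e k, ∫⁻ w, {y | (C y).Nonempty}.indicator 1 (tensor h (toComplex w))
        ∂(unifLaw S) ≤ ENNReal.ofReal (1 - (1 - γ) ^ (2 * k)) := by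
      intro S hS
      refine le_trans (le_of_eq ?_) (unifLaw_candidates_nonempty_le e hk hγ0 hγ1 hS)
      have hN' : MeasurableSet {w | (candidates e k γ w).Nonempty} :=
        measurableSet_setOfPred.2 (measurable_comp_finset (measurableSet_mem_candidates e k γ)
          fun s => s.Nonempty)
      rw [← lintegral_indicator_one hN']
      refine lintegral_congr fun w => ?_
      simp [Set.indicator, hCdef, decode_tensor hi]
    rw [← lintegral_indicator_one hN, hlint _ (measurable_one.indicator hN),
      ENNReal.ofReal_mul (by positivity), ENNReal.ofReal_mul (by positivity),
      ENNReal.ofReal_mul (by positivity), ← hMr, ENNReal.ofReal_inv_of_pos (by positivity),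
      ENNReal.ofReal_pow hγ0.le, ENNReal.ofReal_natCast]
    gcongr
    exact (Finset.sum_le_card_nsmul _ _ _ h1).trans (by simp)
  have hcard := card_goodPairs e k
  have hge := card_goodPairs_ge hkn e position_injective
  refine le_trans ?_ (le_condPointEntropy hb P hV hU hF hC hlaw htwo ht0 ?_)
  · rw [hVN]
    gcongr
    calc (1 - 17 * (k : ℝ) ^ 4 / n) = ((n.choose k : ℝ)⁻¹) ^ 2 *
          ((n.choose k : ℝ) ^ 2 * (1 - 17 * (k : ℝ) ^ 4 / n)) := by
          field_simp
      _ ≤ _ := by gcongr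
  -- Each good set arises from `(2k).choose k` good pairs, so the number of good sets cancels and
  -- the ratio of the two masses is bounded by `t`.
  · refine hlN.trans ?_
    rw [hVN, ← ENNReal.ofReal_mul ht0.le, hcard, ht]
    refine le_of_eq (congrArg _ ?_)
    push_cast
    field_simp

end Eavesdropper

end FullDuplex

end

theorem mainTheorem1
    {n m k s : ℕ} [NeZero n] [NeZero m] (hk : k ≤ n) (hs : 1 ≤ s)
    -- scaling factor, and base of the logarithm (`2` for bits, `e` for nats)
    (γ : ℝ) (hγ0 : 0 < γ) (hγ1 : γ ≤ 1) (b : ℝ) (hb : 2 ≤ b)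
    -- the two factors of the bound are not both negative
    (hn : 17 * (k : ℝ) ^ 4 ≤ n ∨ 1 ≤ FullDuplex.entropyBound b γ k)
    -- the random signals of Alice and Bob
    {Ω : Type*} [MeasurableSpace Ω] (P : Measure Ω) [IsProbabilityMeasure P]
    (βA βB : Ω → Fin n → ℂ)
    (hA : HasLaw βA (FullDuplex.signalLaw n k) P) (hB : HasLaw βB (FullDuplex.signalLaw n k) P)
    (hAB : IndepFun βA βB P)
    -- the channel model: law of the path positions, and nondegenerate Gaussian path gains
    (ν : Measure (Fin s → Fin m)) [IsProbabilityMeasure ν]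
    (G : Fin s → Measure ℂ) [∀ l, IsGaussian (G l)] (hG : ∀ l z, G l ≠ Measure.dirac z) :
    ∀ᵐ h ∂(FullDuplex.channelLaw ν G),
      ENNReal.ofReal ((1 - 17 * (k : ℝ) ^ 4 / n) * (FullDuplex.entropyBound b γ k - 1)) ≤
          FullDuplex.condEntropy b
            (fun ω => FullDuplex.secret h (βA ω) (βB ω))
            (fun ω => FullDuplex.tensor h (βA ω + (γ : ℂ) • βB ω)) P ∧
      ENNReal.ofReal ((1 - 17 * (k : ℝ) ^ 4 / n) * (FullDuplex.entropyBound b γ k - 1)) ≤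
          FullDuplex.condPointEntropy b
            (fun ω => FullDuplex.secret h (βA ω) (βB ω))
            (fun ω => FullDuplex.tensor h (βA ω + (γ : ℂ) • βB ω)) P := by
  filter_upwards [FullDuplex.ae_dft_liftChannel_ne_zero (n := n) hs ν G hG] with h hh
  suffices hmain :
      ENNReal.ofReal ((1 - 17 * (k : ℝ) ^ 4 / n) * (FullDuplex.entropyBound b γ k - 1)) ≤
        FullDuplex.condPointEntropy b
          (fun ω => FullDuplex.secret h (βA ω) (βB ω))
          (fun ω => FullDuplex.tensor h (βA ω + (γ : ℂ) • βB ω)) P from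
    ⟨hmain.trans (lintegral_mono fun y => FullDuplex.pointEntropy_le_shannonEntropy b _), hmain⟩
  have hn0 : (0 : ℝ) < n := by exact_mod_cast Nat.pos_of_ne_zero (NeZero.ne n)
  rcases le_or_gt ((1 - 17 * (k : ℝ) ^ 4 / n) * (FullDuplex.entropyBound b γ k - 1)) 0 with
    hneg | hpos
  · rw [ENNReal.ofReal_of_nonpos hneg]
    exact zero_le
  -- Two negative factors would also give a positive product; `hn` excludes this.
  have hfac : 0 < 1 - 17 * (k : ℝ) ^ 4 / n ∧ 0 < FullDuplex.entropyBound b γ k - 1 := by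
    rcases pos_and_pos_or_neg_and_neg_of_mul_pos hpos with hp | ⟨h1, h2⟩
    · exact hp
    · rcases hn with hn | hn
      · have := (div_le_one hn0).2 hn
        linarith
      · linarith
  -- For `k = 0` the argument of the logarithm is `0 + 1`, so `entropyBound` is 0 and the second
  -- factor would be `-1`.
  have hk0 : 0 < k := by
    rcases Nat.eq_zero_or_pos k with rfl | hk0
    · have := hfac.2
      norm_num [FullDuplex.entropyBound] at this
    · exact hk0
  have hchoose : (0 : ℝ) < (2 * k).choose k := by exact_mod_cast Nat.choose_pos (by omega)
  set t : ℝ := ((2 * k).choose k : ℝ)⁻¹ * ((1 - (1 - γ) ^ (2 * k)) / γ ^ k) with ht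
  have ht0 : 0 < t := by
    have : (1 - γ) ^ (2 * k) < 1 := pow_lt_one₀ (by linarith) (by linarith) (by omega)
    have : 0 < 1 - (1 - γ) ^ (2 * k) := by linarith
    positivity
  refine le_trans ?_ (FullDuplex.le_condPointEntropy_secret hh hk0 hk hγ0 hγ1 hb hA hB hAB ht ht0)
  rw [mul_comm, ENNReal.ofReal_mul hfac.2.le]
  gcongr
  -- The argument yields the bound with `-log_b t`; the extra summand `δᵏ` inside the logarithm of
  -- `entropyBound` only weakens it.
  rw [FullDuplex.entropyBound, neg_le_neg_iff]
  refine Real.logb_le_logb_of_le (by linarith) ht0 ?_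
  have : 0 ≤ (1 - γ) ^ k := pow_nonneg (by linarith) _
  linarith
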